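/- **Conventions.** Let $k$ be an algebraically closed field of characteristic $0$, $\Lambda$ a commutative ring and $\Lambda\to k$ a ring homomorphism (for example $\Lambda=\mathbb Z$, in which case $\Lambda$-linearity is additivity, or $\Lambda=k$). Let $G$ be a finite group, $\hat G$ the set of irreducible characters of $G$ over $k$, and choose for each $c\in\hat G$ an irreducible representation $\rho_c$ with character $c$. The functor $\chi(\rho)=(\mathrm{Hom}_G(\rho_c,\rho))_{c\in\hat G}$ is an equivalence from $\mathrm{Rep}\,G$ (finite-dimensional representations) to finitely generated $k^{\hat G}$-modules, $k^{\hat G}\cong Z(kG)$; let $\otimes_Z$ be the tensor product on $\mathrm{Rep}\,G$ corresponding under $\chi$ to the tensor product of $k^{\hat G}$-modules, and $A_Z=(\mathrm{Rep}\,G,\otimes_Z)$. For $\alpha\in\mathrm{Aut}(G)$ let $\kappa'(\alpha):A_Z\to A_Z$ be the functor $\rho\mapsto\rho\circ\alpha$. For $b\in G$ let $\iota(b)(x)=b^{-1}xb$. Let $\mathfrak S$ be a site with a final object $S_0$ and $\{u_i:T_i\to S_0\}_i$ a covering. Let $\mathcal B\to\mathfrak S$ be a $\Lambda$-linear category fibred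 in abelian tensor categories: each fibre $\mathcal B_S$ is an abelian, $\Lambda$-linear, symmetric monoidal category in which $\otimes$ is $\Lambda$-bilinear and $y\otimes-$ preserves colimits for every object $y$; the pull-back functors are $\Lambda$-linear, symmetric strong monoidal and preserve colimits; and the canonical isomorphisms between composites of pull-backs are monoidal. Assume that $\mathcal B$ is a stack. Denote by $u_S$ the unit object of $\mathcal B_S$. For $T$ in $\mathfrak S$ let $\underline{A_Z}(\mathcal B_{/T})$ be the category fibred in groupoids over $\mathfrak S/T$ whose fibre over $S\to T$ consists of the tensor functors $A_Z\to\mathcal B_S$ (symmetric strong monoidal, $\Lambda$-linear, colimit-preserving) and their monoidal natural isomorphisms. A tensor structure on a functor between symmetric monoidal categories is the structure of a symmetric strong monoidal functor. Write $T_{ij}=T_i\times_{S_0} T_j$, etc. (the slices $\mathfrak S/T_{ij}$, etc., are understood as the categories of objects equipped with maps to $T_i$ and $T_j$, etc.). A *2-descent datum of stacks* $(X_i,\chi_{ij},\varphi_{ijk})$ consists of stacks in groupoids $X_i$ over $\mathfrak S/T_i$, equivalences $\chi_{ij}:X_i|_{T_{ij}}\to X_j|_{T_{ij}}$ of fibred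 categories, and natural isomorphisms $\varphi_{ijk}:\chi_{jk}\circ\chi_{ij}\Rightarrow\chi_{ik}$ over $T_{ijk}$, such that the two natural isomorphisms $\chi_{kl}\circ\chi_{jk}\circ\chi_{ij}\Rightarrow\chi_{il}$ over $T_{ijkl}$ obtained from the $\varphi$'s, namely $\varphi_{ikl}\circ(\chi_{kl}\,\varphi_{ijk})$ and $\varphi_{ijl}\circ(\varphi_{jkl}\,\chi_{ij})$, coincide. **Corollary.** Let $\alpha_{ij}\in\mathrm{Aut}(G)$ and $\beta_{ijk}\in G$ satisfy the 2-cocycle conditions $$\alpha_{jk}\circ\alpha_{ij}=\alpha_{ik}\circ\iota(\beta_{ijk}),\qquad \alpha_{ij}^{-1}(\beta_{jkl})\,\beta_{ijl}=\beta_{ijk}\,\beta_{ikl}$$ for all indices, and put $\lambda'_{ij}=\kappa'(\alpha_{ij})$. (a) The functors $\lambda'_{ij}$ can be given tensor structures for which the natural isomorphisms $\lambda'_{ij}\circ\lambda'_{jk}\Rightarrow\lambda'_{ik}$ with components $\rho(\alpha_{ik}(\beta_{ijk}))$ are monoidal for all $i,j,k$. (b) For every choice of tensor structures on the functors $\lambda'_{ij}$,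 there is exactly one family of monoidal natural isomorphisms $\mu'_{ijk}:\lambda'_{ij}\circ\lambda'_{jk}\Rightarrow\lambda'_{ik}$ (hence, for tensor structures as in (a), that of (a)), and $(\underline{A_Z}(\mathcal B_{/T_i}),\lambda'_{ij},\mu'_{ijk})$, where $\lambda'_{ij}$ acts by $F\mapsto F\circ\lambda'_{ij}$ and $\mu'_{ijk}$ accordingly, is a 2-descent datum of stacks. (c) This datum glues: there is a stack in groupoids $\hat{\mathscr Y}$ over $\mathfrak S$ with equivalences $\psi_i:\hat{\mathscr Y}|_{T_i}\to\underline{A_Z}(\mathcal B_{/T_i})$ and natural isomorphisms $\theta_{ij}:\lambda'_{ij}\circ\psi_i\Rightarrow\psi_j$ over $T_{ij}$ such that the two natural isomorphisms $\lambda'_{jk}\circ\lambda'_{ij}\circ\psi_i\Rightarrow\psi_k$ over $T_{ijk}$ (through $\theta_{ij},\theta_{jk}$, and through $\mu'_{ijk},\theta_{ik}$) coincide; here $\lambda'_{ij}$ and $\mu'_{ijk}$ stand for the induced morphisms of stacks. Moreover, for every $i$, $\hat{\mathscr Y}|_{T_i}$ is equivalent to $\hat G\times T_i$, that is, to the category fibred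 in sets over $\mathfrak S/T_i$ given by the functor of points $(S\to T_i)\mapsto\mathrm{Hom}_{\Lambda\text{-alg}}(k^{\hat G},\mathrm{End}(u_S))$ of $\mathrm{Spec}(k^{\hat G})=\coprod_{\hat G}\mathrm{Spec}(k)$. -/

import Mathlib

open CategoryTheory CategoryTheory.Limits CategoryTheory.MonoidalCategory Bicategory Opposite

universe v''' u''' v'' u'' v' u' v u v₁ u₁ v₂ u₂ v₃ u₃ v₄ u₄ v₅ u₅ w w' w''

namespace DualGerbe

noncomputable section

section Rep

variable (k G : Type u) [Field k] [Group G]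

/-- The set `Ĝ` of irreducible characters of `G` over `k`. -/
def IrrChar : Type u := {c : G → k // ∃ V : FDRep k G, Simple V ∧ V.character = c}

variable {k G}

/-- An irreducible representation with the given character. -/
def irr (c : IrrChar k G) : FDRep k G := c.2.choose

instance simple_irr (c : IrrChar k G) : Simple (irr c) := c.2.choose_spec.1

lemma irr_character (c : IrrChar k G) : (irr c).character = c.1 := c.2.choose_spec.2

variable (k G)

/-- `χ(ρ) = ∏ i, Hom_G(ρ_i, ρ)`, as a functor with values in the category of `Ĝ`-indexed families
of finite dimensional vector spaces, that is, of finitely generated modules over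
`k ^ Ĝ ≅ Z(kG)`. -/
def chi : FDRep k G ⥤ (∀ _ : IrrChar k G, FGModuleCat.{u} k) where
  obj V c := FGModuleCat.of k (irr c ⟶ V)
  map f c := FGModuleCat.ofHom (Linear.rightComp k (irr c) f)
  map_id V := by
    funext c
    exact FGModuleCat.hom_ext (LinearMap.ext fun x => Category.comp_id x)
  map_comp f g := by
    funext c
    exact FGModuleCat.hom_ext (LinearMap.ext fun x => (Category.assoc x f g).symm)

variable {k G}

lemma chi_map_eq_iff {V W : FDRep k G} {f g : V ⟶ W} :
    (chi k G).map f = (chi k G).map g ↔ ∀ (c : IrrChar k G) (x : irr c ⟶ V), x ≫ f = x ≫ g := by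
  constructor
  · intro h c x
    exact LinearMap.congr_fun (congrArg (fun t => (t c).hom.hom) h) x
  · intro h
    funext c
    exact FGModuleCat.hom_ext (LinearMap.ext fun x => h c x)

/-- A family of linear maps `Hom(ρ_c, V) → Hom(ρ_c, W)` comes from a unique morphism `V ⟶ W`. -/
def Good (V : FDRep k G) : Prop :=
  ∀ W : FDRep k G,
    (∀ f g : V ⟶ W, (∀ (c : IrrChar k G) (x : irr c ⟶ V), x ≫ f = x ≫ g) → f = g) ∧
    ∀ φ : ∀ c : IrrChar k G, (irr c ⟶ V) →ₗ[k] (irr c ⟶ W),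
      ∃ f : V ⟶ W, ∀ (c : IrrChar k G) (x : irr c ⟶ V), φ c x = x ≫ f

lemma Good.of_retracts {V W W' : FDRep k G} (i : W ⟶ V) (p : V ⟶ W) (i' : W' ⟶ V) (p' : V ⟶ W')
    (h : p ≫ i + p' ≫ i' = 𝟙 V) (hW : Good W) (hW' : Good W') : Good V := by
  intro X
  refine ⟨fun f g hfg => ?_, fun φ => ?_⟩
  · have h1 : i ≫ f = i ≫ g := (hW X).1 _ _ fun c x => by
      simpa using hfg c (x ≫ i)
    have h2 : i' ≫ f = i' ≫ g := (hW' X).1 _ _ fun c x => by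
      simpa using hfg c (x ≫ i')
    rw [← Category.id_comp f, ← Category.id_comp g, ← h]
    simp only [Preadditive.add_comp, Category.assoc, h1, h2]
  · obtain ⟨f, hf⟩ := (hW X).2 fun c => (φ c).comp (Linear.rightComp k (irr c) i)
    obtain ⟨f', hf'⟩ := (hW' X).2 fun c => (φ c).comp (Linear.rightComp k (irr c) i')
    refine ⟨p ≫ f + p' ≫ f', fun c x => ?_⟩
    have e1 := hf c (x ≫ p)
    have e2 := hf' c (x ≫ p')
    simp only [LinearMap.comp_apply, Linear.rightComp_apply, Category.assoc] at e1 e2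
    rw [Preadditive.comp_add, ← e1, ← e2, ← map_add, ← Preadditive.comp_add, h, Category.comp_id]

lemma Good.of_isZero {V : FDRep k G} (h : IsZero V) : Good V := by
  intro W
  refine ⟨fun f g _ => h.eq_of_src f g, fun φ => ⟨0, fun c x => ?_⟩⟩
  rw [h.eq_of_tgt x 0]
  simp

lemma Good.of_iso {V W : FDRep k G} (e : V ≅ W) (hV : Good V) : Good W :=
  Good.of_retracts e.hom e.inv (0 : V ⟶ W) 0 (by simp) hV hV

lemma finrank_retract_lt {V W : FDRep k G} (i : W ⟶ V) (p : V ⟶ W) (h : i ≫ p = 𝟙 W)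
    (hi : ¬ IsIso i) : Module.finrank k (W ⟶ W) < Module.finrank k (V ⟶ V) := by
  let Φ : (W ⟶ W) →ₗ[k] (V ⟶ V) := (Linear.leftComp k V p).comp (Linear.rightComp k W i)
  have hΦ : ∀ f, Φ f = p ≫ f ≫ i := fun f => rfl
  have inj : Function.Injective Φ := by
    intro f g hfg
    rw [hΦ, hΦ] at hfg
    have := congrArg (fun t => i ≫ t ≫ p) hfg
    simpa [reassoc_of% h, h] using this
  refine lt_of_le_of_ne (LinearMap.finrank_le_finrank_of_injective inj) fun heq => hi ?_
  obtain ⟨f, hf⟩ := (LinearMap.injective_iff_surjective_of_finrank_eq_finrank heq).1 inj (𝟙 V)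
  rw [hΦ] at hf
  have hp : p ≫ i = 𝟙 V := by
    calc p ≫ i = p ≫ (i ≫ p) ≫ f ≫ i := by
          rw [Category.assoc, hf, Category.comp_id]
      _ = 𝟙 V := by rw [h, Category.id_comp, hf]
  exact ⟨p, h, hp⟩

lemma not_nonempty_iso_irr {c d : IrrChar k G} (h : c ≠ d) : ¬ Nonempty (irr c ≅ irr d) := by
  rintro ⟨e⟩
  have := FDRep.char_iso e
  rw [irr_character, irr_character] at this
  exact h (Subtype.ext this)

section

variable [IsAlgClosed k] [CharZero k] [Finite G]

instance neZero_card : NeZero (Nat.card G : k) := ⟨Nat.cast_ne_zero.2 Nat.card_pos.ne'⟩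

open scoped Classical in
lemma sum_char [Fintype G] (V W : FDRep k G) [Simple V] [Simple W] :
    (Nat.card G : k)⁻¹ * ∑ g : G, V.character g * W.character g⁻¹ =
      if Nonempty (V ≅ W) then 1 else 0 := by
  have := invertibleOfNonzero (NeZero.ne (Nat.card G : k))
  simpa using FDRep.char_orthonormal V W

lemma nonempty_iso_of_character_eq {V W : FDRep k G} [Simple V] [Simple W]
    (h : V.character = W.character) : Nonempty (V ≅ W) := by
  classical
  have := Fintype.ofFinite G
  have h1 := sum_char V W
  have h2 := sum_char W W
  rw [h, h2, if_pos ⟨Iso.refl W⟩] at h1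
  by_contra h3
  rw [if_neg h3] at h1
  exact one_ne_zero h1

instance finite_irrChar : Finite (IrrChar k G) := by
  classical
  have := Fintype.ofFinite G
  have hli : LinearIndependent k (fun c : IrrChar k G => c.1) := by
    rw [linearIndependent_iff']
    intro s a hs d hd
    have h0 : ∀ g, ∑ c ∈ s, a c * c.1 g = 0 := fun g => by
      simpa using congrFun hs g
    have h1 : ∑ c ∈ s, a c * ((Nat.card G : k)⁻¹ * ∑ g : G, c.1 g * d.1 g⁻¹) = 0 := by
      calc _ = (Nat.card G : k)⁻¹ * ∑ g : G, (∑ c ∈ s, a c * c.1 g) * d.1 g⁻¹ := by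
            simp only [Finset.mul_sum, Finset.sum_mul]
            rw [Finset.sum_comm]
            refine Finset.sum_congr rfl fun _ _ => Finset.sum_congr rfl fun _ _ => by ring
        _ = 0 := by simp [h0]
    rw [Finset.sum_eq_single d] at h1
    · have := sum_char (irr d) (irr d)
      rw [if_pos ⟨Iso.refl _⟩] at this
      rw [irr_character] at this
      rwa [this, mul_one] at h1
    · intro c _ hcd
      have := sum_char (irr c) (irr d)
      rw [if_neg, irr_character, irr_character] at this
      · rw [this, mul_zero]
      · rintro ⟨e⟩
        have := FDRep.char_iso e
        rw [irr_character, irr_character] at this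
        exact hcd (Subtype.ext this)
    · exact fun h => absurd hd h
  exact hli.finite

lemma good_irr (c : IrrChar k G) : Good (irr c) := by
  classical
  intro W
  refine ⟨fun f g h => by simpa using h c (𝟙 _), fun φ => ⟨φ c (𝟙 _), fun d x => ?_⟩⟩
  by_cases hdc : d = c
  · subst hdc
    have h1 : Module.finrank k (irr d ⟶ irr d) = 1 := by
      rw [FDRep.finrank_hom_simple_simple, if_pos ⟨Iso.refl _⟩]
    obtain ⟨a, rfl⟩ := (finrank_eq_one_iff_of_nonzero' (𝟙 (irr d)) (id_nonzero _)).1 h1 x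
    rw [map_smul, Linear.smul_comp, Category.id_comp]
  · have h0 : Module.finrank k (irr d ⟶ irr c) = 0 := by
      rw [FDRep.finrank_hom_simple_simple, if_neg (not_nonempty_iso_irr hdc)]
    have := Module.finrank_zero_iff.1 h0
    rw [Subsingleton.elim x 0]
    simp

lemma good (V : FDRep k G) : Good V := by
  induction hn : Module.finrank k (V ⟶ V) using Nat.strong_induction_on generalizing V with
  | _ n ih =>
    subst hn
    by_cases hz : IsZero V
    · exact Good.of_isZero hz
    by_cases hs : Simple V
    · let c : IrrChar k G := ⟨V.character, V, hs, rfl⟩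
      obtain ⟨e⟩ := nonempty_iso_of_character_eq (irr_character c : _ = V.character)
      exact (good_irr c).of_iso e
    · have : ∃ (W : FDRep k G) (i : W ⟶ V), Mono i ∧ ¬ (IsIso i ↔ i ≠ 0) := by
        by_contra hcon
        push Not at hcon
        exact hs ⟨fun {W} f hf => hcon W f hf⟩
      obtain ⟨W, i, hi, hiso⟩ := this
      have hi0 : i ≠ 0 ∧ ¬ IsIso i := by
        by_cases h : IsIso i
        · exfalso
          have h0 : i = 0 := by
            by_contra h0
            exact hiso ⟨fun _ => h0, fun _ => h⟩
          apply hz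
          rw [IsZero.iff_id_eq_zero, ← IsIso.inv_hom_id i]
          simp [h0]
        · refine ⟨fun h0 => hiso ⟨fun h' => absurd h' h, fun h' => absurd h0 h'⟩, h⟩
      let r : V ⟶ W := Injective.factorThru (𝟙 W) i
      have hr : i ≫ r = 𝟙 W := Injective.comp_factorThru _ _
      let q : V ⟶ kernel r := kernel.lift r (𝟙 V - r ≫ i) (by simp [Preadditive.sub_comp, hr])
      have hq : q ≫ kernel.ι r = 𝟙 V - r ≫ i := kernel.lift_ι _ _ _
      have hq' : kernel.ι r ≫ q = 𝟙 _ := by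
        rw [← cancel_mono (kernel.ι r), Category.assoc, hq, Preadditive.comp_sub,
          kernel.condition_assoc]
        simp
      refine Good.of_retracts i r (kernel.ι r) q (by rw [hq]; abel)
        (ih _ (finrank_retract_lt i r hr hi0.2) W rfl)
        (ih _ (finrank_retract_lt (kernel.ι r) q hq' ?_) _ rfl)
      intro h
      have hr0 : r = 0 := by
        rw [← cancel_epi (kernel.ι r), kernel.condition, comp_zero]
      rw [hr0, comp_zero] at hr
      exact hi0.1 (by rw [← Category.id_comp i, ← hr, zero_comp])

instance chi_faithful : (chi k G).Faithful where
  map_injective {V W} f g h := ((good V) W).1 f g (chi_map_eq_iff.1 h)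

instance chi_full : (chi k G).Full where
  map_surjective {V W} φ := by
    obtain ⟨f, hf⟩ := ((good V) W).2 fun c => (φ c).hom.hom
    refine ⟨f, ?_⟩
    funext c
    exact FGModuleCat.hom_ext (LinearMap.ext fun x => (hf c x).symm)

instance chi_essSurj : (chi k G).EssSurj where
  mem_essImage M := by
    classical
    have := Fintype.ofFinite (IrrChar k G)
    have := HasFiniteBiproducts.of_hasFiniteProducts (C := FDRep k G)
    let J := Σ c : IrrChar k G, Fin (Module.finrank k (M c))
    let V : FDRep k G := ⨁ fun j : J => irr j.1
    have key : ∀ d, Module.finrank k (irr d ⟶ V) = Module.finrank k (M d) := by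
      intro d
      let e : (irr d ⟶ V) ≃ₗ[k] (∀ j : J, irr d ⟶ irr j.1) :=
        { toFun := fun f j => f ≫ biproduct.π _ j
          map_add' := fun f g => by funext j; simp
          map_smul' := fun a f => by funext j; simp
          invFun := fun f => biproduct.lift f
          left_inv := fun f => by ext1 j; simp
          right_inv := fun f => by funext j; simp }
      rw [e.finrank_eq, Module.finrank_pi_fintype, Fintype.sum_sigma]
      rw [Finset.sum_eq_single d]
      · simp [FDRep.finrank_hom_simple_simple, Nonempty.intro (Iso.refl (irr d))]
      · intro c _ hcd
        simp [FDRep.finrank_hom_simple_simple, not_nonempty_iso_irr hcd.symm]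
      · simp
    refine ⟨V, ⟨Pi.isoMk fun d => ?_⟩⟩
    exact (LinearEquiv.ofFinrankEq (irr d ⟶ V) (M d) (key d)).toFGModuleCatIso

instance chi_isEquivalence : (chi k G).IsEquivalence where

variable (k G) in
/-- The equivalence `χ⁻¹ : Z(kG)-mod ≌ Rep G`. -/
def chiEquiv : (∀ _ : IrrChar k G, FGModuleCat.{u} k) ≌ FDRep k G :=
  (chi k G).asEquivalence.symm

end

variable (k G) in
/-- The category `Rep G` of finite dimensional representations, to be endowed with the tensor
product `⊗_Z`. -/
def RepZ : Type (u + 1) := FDRep k G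

instance repZCategory : Category.{u} (RepZ k G) := inferInstanceAs (Category (FDRep k G))

instance repZPreadditive : Preadditive (RepZ k G) := inferInstanceAs (Preadditive (FDRep k G))

instance repZLinear : Linear k (RepZ k G) := inferInstanceAs (Linear k (FDRep k G))

section

variable [IsAlgClosed k] [CharZero k] [Finite G]

/-- The tensor product `⊗_Z` on `Rep G`: the tensor product of modules over `Z(kG) ≅ k ^ Ĝ`,
transported to `Rep G` along `χ`. -/
instance repZMonoidal : MonoidalCategory (RepZ k G) :=
  inferInstanceAs (MonoidalCategory (Monoidal.Transported (chiEquiv k G)))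

instance repZSymmetric : SymmetricCategory (RepZ k G) :=
  inferInstanceAs (SymmetricCategory (Monoidal.Transported (chiEquiv k G)))

end

/-- The functor `κ'(α) : ρ ↦ ρ ∘ α` on `(Rep G, ⊗_Z)`. -/
def resZ (α : G ≃* G) : RepZ k G ⥤ RepZ k G :=
  Action.res (FGModuleCat.{u} k) (α : G →* G)

instance resZ_linear (α : G ≃* G) : (resZ (k := k) α).Linear k where
  map_smul _ _ := rfl

instance resZ_isEquivalence (α : G ≃* G) : (resZ (k := k) α).IsEquivalence :=
  inferInstanceAs (Action.resEquiv (FGModuleCat.{u} k) α).functor.IsEquivalence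

/-- For `α₂ ∘ α₁ = α₃ ∘ ι(b)`, the natural isomorphism `μ : κ'(α₁) ∘ κ'(α₂) ⟹ κ'(α₃)` given by
`μ_ρ = ρ(α₃(b))`. -/
def muZ (α₁ α₂ α₃ : G ≃* G) (b : G) (h : ∀ g, α₂ (α₁ g) = α₃ (b⁻¹ * g * b)) :
    resZ α₂ ⋙ resZ α₁ ≅ resZ (k := k) α₃ :=
  NatIso.ofComponents
    (fun V : FDRep k G => (Action.mkIso (V.ρAut (α₃ b)) (fun g => by
      change Action.ρ V (α₂ (α₁ g)) ≫ Action.ρ V (α₃ b) = Action.ρ V (α₃ b) ≫ Action.ρ V (α₃ g)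
      rw [← End.mul_def, ← End.mul_def, ← map_mul, ← map_mul, h, ← map_mul, ← map_mul]
      congr 2
      group) : (Action.res _ (α₁ : G →* G)).obj ((Action.res _ (α₂ : G →* G)).obj V) ≅
        (Action.res _ (α₃ : G →* G)).obj V))
    (fun {V W} (f : (V : FDRep k G) ⟶ W) => Action.Hom.ext (f.comm (α₃ b)).symm)

end Rep

section Fibred

variable {C : Type u₁} [Category.{v₁} C] {D : Type u₃} [Category.{v₃} D]

/-- Fibred categories over `C`, given by their fibres and pull-back functors. -/
abbrev FibCat (C : Type u) [Category.{v} C] : Type (max u v (u' + 1) (v' + 1)) :=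
  LocallyDiscrete Cᵒᵖ ⥤ᵖ Cat.{v', u'}

/-- The fibre category over `S`. -/
abbrev Fib (X : FibCat.{v₂, u₂} C) (S : C) : Type u₂ := X.obj (.mk (op S))

/-- The pull-back functor `f^*`. -/
abbrev pull (X : FibCat.{v₂, u₂} C) {S' S : C} (f : S' ⟶ S) : Fib X S ⥤ Fib X S' :=
  (X.map f.op.toLoc).toFunctor

/-- The canonical isomorphism `id^* ≅ id`. -/
def pullId (X : FibCat.{v₂, u₂} C) {S : C} (f : S ⟶ S) (hf : f = 𝟙 S := by cat_disch) :
    pull X f ≅ 𝟭 (Fib X S) :=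
  Cat.Hom.toNatIso (X.mapId' f.op.toLoc (by subst hf; rfl))

/-- The canonical isomorphism `(f ≫ g)^* ≅ f^* ∘ g^*`. -/
def pullComp (X : FibCat.{v₂, u₂} C) {S'' S' S : C} (f : S'' ⟶ S') (g : S' ⟶ S)
    (h : S'' ⟶ S) (w : f ≫ g = h := by cat_disch) : pull X h ≅ pull X g ⋙ pull X f :=
  Cat.Hom.toNatIso (X.mapComp' g.op.toLoc f.op.toLoc h.op.toLoc (by subst w; rfl))

lemma pullComp_assoc (X : FibCat.{v₂, u₂} C) {S₃ S₂ S₁ S₀ : C} (f : S₃ ⟶ S₂)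
    (g : S₂ ⟶ S₁) (h : S₁ ⟶ S₀) (fg : S₃ ⟶ S₁) (gh : S₂ ⟶ S₀) (fgh : S₃ ⟶ S₀)
    (w₁ : f ≫ g = fg) (w₂ : g ≫ h = gh) (w₃ : f ≫ gh = fgh) (x : Fib X S₀) :
    (pullComp X f gh fgh w₃).hom.app x ≫ (pull X f).map ((pullComp X g h gh w₂).hom.app x) =
      (pullComp X fg h fgh (by rw [← w₁, ← w₃, ← w₂, Category.assoc])).hom.app x ≫
        (pullComp X f g fg w₁).hom.app ((pull X h).obj x) := by
  subst w₁ w₂ w₃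
  have := X.mapComp'₀₂₃_hom_comp_mapComp'_hom_whiskerRight_app h.op.toLoc g.op.toLoc f.op.toLoc
    (g ≫ h).op.toLoc (f ≫ g).op.toLoc (f ≫ g ≫ h).op.toLoc rfl rfl rfl x
  exact this

lemma pullComp_assoc_eqToHom (X : FibCat.{v₂, u₂} C) {S₃ S₂ S₁ S₀ : C} (f : S₃ ⟶ S₂)
    (g : S₂ ⟶ S₁) (h : S₁ ⟶ S₀) {p q : S₃ ⟶ S₀} (hpq : p = q) (x : Fib X S₀)
    (hp : f ≫ g ≫ h = p := by rfl) (hq : (f ≫ g) ≫ h = q := by rfl) :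
    (pullComp X f (g ≫ h) p hp).hom.app x ≫ (pull X f).map ((pullComp X g h _ rfl).hom.app x) ≫
      𝟙 _ ≫ (pullComp X f g _ rfl).inv.app ((pull X h).obj x) ≫
        (pullComp X (f ≫ g) h q hq).inv.app x = eqToHom (by rw [hpq]) := by
  subst hpq
  rw [← Category.assoc, pullComp_assoc X f g h (f ≫ g) (g ≫ h) p rfl rfl hp x, eqToHom_refl]
  simp only [Category.id_comp, Category.assoc]
  erw [Iso.hom_inv_id_app_assoc]
  exact Iso.hom_inv_id_app _ _

lemma pullComp_id_left (X : FibCat.{v₂, u₂} C) {S' S : C} (i : S' ⟶ S') (hi : i = 𝟙 S')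
    (f : S' ⟶ S) (x : Fib X S) :
    (pullComp X i f f).hom.app x ≫ (pullId X i hi).hom.app ((pull X f).obj x) = 𝟙 _ := by
  subst hi
  have := X.mapComp'_comp_id_hom_app f.op.toLoc x
  have e : (pullComp X (𝟙 S') f f).hom.app x = (pullId X (𝟙 S') rfl).inv.app ((pull X f).obj x) := by
    refine this.trans ?_
    simp [pullId, Pseudofunctor.mapId'_eq_mapId]
  rw [e, Iso.inv_hom_id_app]
  rfl

lemma pullComp_id_right (X : FibCat.{v₂, u₂} C) {S' S : C} (i : S ⟶ S) (hi : i = 𝟙 S)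
    (f : S' ⟶ S) (x : Fib X S) :
    (pullComp X f i f).hom.app x ≫ (pull X f).map ((pullId X i hi).hom.app x) = 𝟙 _ := by
  subst hi
  have := X.mapComp'_id_comp_hom_app f.op.toLoc x
  have e : (pullComp X f (𝟙 S) f).hom.app x = (pull X f).map ((pullId X (𝟙 S) rfl).inv.app x) := by
    refine this.trans ?_
    simp [pullId, Pseudofunctor.mapId'_eq_mapId]
    rfl
  rw [e, ← Functor.map_comp, Iso.inv_hom_id_app]
  exact CategoryTheory.Functor.map_id _ _

lemma map₂_comp_eq (X : FibCat.{v₂, u₂} C) {a b : LocallyDiscrete Cᵒᵖ} {f g h : a ⟶ b}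
    (p : f ⟶ g) (q : g ⟶ h) (r : f ⟶ h) {Z : X.obj a ⟶ X.obj b} (z : X.map h ⟶ Z) :
    X.map₂ p ≫ X.map₂ q ≫ z = X.map₂ r ≫ z := by
  rw [← Category.assoc, ← X.map₂_comp, Subsingleton.elim (p ≫ q) r]

/-- The restriction `P⁻¹ X` of a fibred category along a functor `P`. -/
def restr (P : D ⥤ C) (X : FibCat.{v₂, u₂} C) : FibCat.{v₂, u₂} D :=
  P.op.toPseudofunctor.comp X

lemma pullId_restr (P : D ⥤ C) (X : FibCat.{v₂, u₂} C) {S : D} (f : S ⟶ S) (hf : f = 𝟙 S) :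
    pullId (restr P X) f hf = pullId X (P.map f) (by rw [hf, P.map_id]) := by
  refine congrArg Cat.Hom.toNatIso (Iso.ext ?_)
  exact map₂_comp_eq X _ _ _ _

lemma pullComp_restr (P : D ⥤ C) (X : FibCat.{v₂, u₂} C) {S'' S' S : D} (f : S'' ⟶ S') (g : S' ⟶ S)
    (h : S'' ⟶ S) (w : f ≫ g = h) :
    pullComp (restr P X) f g h w =
      pullComp X (P.map f) (P.map g) (P.map h) (by rw [← w, P.map_comp]) := by
  refine congrArg Cat.Hom.toNatIso (Iso.ext ?_)
  exact map₂_comp_eq X _ _ _ _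

end Fibred

section Tensor

variable {C : Type u₁} [Category.{v₁} C] {D : Type u₃} [Category.{v₃} D]

/-- A category fibred in abelian tensor categories: every fibre is an abelian category with a
symmetric monoidal structure such that `y ⊗ -` is additive and preserves small colimits for every
`y`, and the pull-back functors are symmetric strong monoidal and preserve small colimits. The
canonical isomorphisms `id^* ≅ id` and `(f ≫ g)^* ≅ f^* ∘ g^*` are compatible with the tensor
structures. -/
class AbelianTensorFibred (B : FibCat.{v₂, u₂} C) where
  abelian (S : C) : Abelian (Fib B S)
  monoidal (S : C) : MonoidalCategory (Fib B S)
  symmetric (S : C) : SymmetricCategory (Fib B S)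
  monoidalPreadditive (S : C) : MonoidalPreadditive (Fib B S)
  tensorLeft_colimits {S : C} (y : Fib B S) : PreservesColimits (tensorLeft y)
  pull_braided {S' S : C} (f : S' ⟶ S) : (pull B f).Braided
  pull_colimits {S' S : C} (f : S' ⟶ S) : PreservesColimits (pull B f)
  pullId_monoidal (S : C) : NatTrans.IsMonoidal (pullId B (𝟙 S)).hom
  pullComp_monoidal {S'' S' S : C} (f : S'' ⟶ S') (g : S' ⟶ S) :
    NatTrans.IsMonoidal (pullComp B f g (f ≫ g)).hom

attribute [reducible, instance] AbelianTensorFibred.abelian AbelianTensorFibred.monoidal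
  AbelianTensorFibred.symmetric AbelianTensorFibred.pull_braided

attribute [instance] AbelianTensorFibred.monoidalPreadditive
  AbelianTensorFibred.tensorLeft_colimits AbelianTensorFibred.pull_colimits

/-- The structure of a `Λ`-linear fibred category on a category fibred in abelian tensor
categories: homs, tensor products and pull-backs are `Λ`-linear. There is exactly one such
structure for `Λ = ℤ`. -/
class LinearFibred (Λ : Type w) [CommRing Λ] (B : FibCat.{v₂, u₂} C) [AbelianTensorFibred B] where
  linear (S : C) : Linear Λ (Fib B S)
  monoidalLinear (S : C) : MonoidalLinear Λ (Fib B S)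
  pull_linear {S' S : C} (f : S' ⟶ S) : (pull B f).Linear Λ

attribute [reducible, instance] LinearFibred.linear

attribute [instance] LinearFibred.monoidalLinear LinearFibred.pull_linear

instance pullId_isMonoidal (B : FibCat.{v₂, u₂} C) [AbelianTensorFibred B] {S : C} (f : S ⟶ S)
    (hf : f = 𝟙 S) : NatTrans.IsMonoidal (pullId B f hf).hom := by
  subst hf
  exact AbelianTensorFibred.pullId_monoidal S

instance pullComp_isMonoidal (B : FibCat.{v₂, u₂} C) [AbelianTensorFibred B] {S'' S' S : C}
    (f : S'' ⟶ S') (g : S' ⟶ S) (h : S'' ⟶ S) (w : f ≫ g = h) :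
    NatTrans.IsMonoidal (pullComp B f g h w).hom := by
  subst w
  exact AbelianTensorFibred.pullComp_monoidal f g

instance restr_abelianTensorFibred (P : D ⥤ C) (B : FibCat.{v₂, u₂} C) [AbelianTensorFibred B] :
    AbelianTensorFibred (restr P B) where
  abelian S := (inferInstance : Abelian (Fib B (P.obj S)))
  monoidal S := (inferInstance : MonoidalCategory (Fib B (P.obj S)))
  symmetric S := (inferInstance : SymmetricCategory (Fib B (P.obj S)))
  monoidalPreadditive S := (inferInstance : MonoidalPreadditive (Fib B (P.obj S)))
  tensorLeft_colimits {S} y :=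
    AbelianTensorFibred.tensorLeft_colimits (B := B) (S := P.obj S) y
  pull_braided f := (inferInstance : (pull B (P.map f)).Braided)
  pull_colimits f := (inferInstance : PreservesColimits (pull B (P.map f)))
  pullId_monoidal S := by
    rw [pullId_restr]
    exact pullId_isMonoidal B _ (P.map_id S)
  pullComp_monoidal f g := by
    rw [pullComp_restr]
    exact pullComp_isMonoidal B _ _ _ (P.map_comp f g).symm

instance restr_linearFibred (Λ : Type w) [CommRing Λ] (P : D ⥤ C) (B : FibCat.{v₂, u₂} C)
    [AbelianTensorFibred B] [LinearFibred Λ B] : LinearFibred Λ (restr P B) where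
  linear S := (inferInstance : Linear Λ (Fib B (P.obj S)))
  monoidalLinear S := (inferInstance : MonoidalLinear Λ (Fib B (P.obj S)))
  pull_linear f := (inferInstance : (pull B (P.map f)).Linear Λ)

end Tensor

section TensFun

/-- A tensor functor `A ⥤ M`: a symmetric strong monoidal functor which preserves colimits and is
compatible with the action of `Λ`. -/
structure TensFun (Λ : Type w) [CommRing Λ] (k : Type w') [CommRing k] [Algebra Λ k]
    (A : Type u₃) [Category.{v₃} A]
    [Preadditive A] [Linear k A] [MonoidalCategory A] [SymmetricCategory A]
    (M : Type u₂) [Category.{v₂} M] [Preadditive M] [Linear Λ M] [MonoidalCategory M]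
    [SymmetricCategory M] where
  /-- the underlying functor -/
  functor : A ⥤ M
  /-- the symmetric strong monoidal structure -/
  braided : functor.Braided
  map_smul (r : Λ) {a b : A} (f : a ⟶ b) :
    functor.map (algebraMap Λ k r • f) = r • functor.map f
  colimits : PreservesColimits functor

namespace TensFun

attribute [instance] TensFun.braided TensFun.colimits

variable {Λ : Type w} [CommRing Λ] {k : Type w'} [CommRing k] [Algebra Λ k]
  {A : Type u₃} [Category.{v₃} A]
  [Preadditive A] [Linear k A] [MonoidalCategory A] [SymmetricCategory A]
  {M : Type u₂} [Category.{v₂} M] [Preadditive M] [Linear Λ M] [MonoidalCategory M]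
  [SymmetricCategory M] {N : Type u₂} [Category.{v₂} N] [Preadditive N] [Linear Λ N]
  [MonoidalCategory N] [SymmetricCategory N]

/-- Morphisms of tensor functors: (symmetric) monoidal natural isomorphisms. -/
@[ext]
structure Hom (F F' : TensFun Λ k A M) where
  /-- the underlying natural isomorphism -/
  iso : F.functor ≅ F'.functor
  monoidal : NatTrans.IsMonoidal iso.hom

attribute [instance] Hom.monoidal

/-- The groupoid of tensor functors and monoidal natural isomorphisms. -/
instance category : Category (TensFun Λ k A M) where
  Hom := Hom
  id F := ⟨Iso.refl _, inferInstanceAs (NatTrans.IsMonoidal (𝟙 F.functor))⟩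
  comp f g := ⟨f.iso ≪≫ g.iso, inferInstanceAs (NatTrans.IsMonoidal (f.iso.hom ≫ g.iso.hom))⟩

@[simp] lemma id_iso (F : TensFun Λ k A M) : Hom.iso (𝟙 F) = Iso.refl _ := rfl

@[simp] lemma comp_iso {F F' F'' : TensFun Λ k A M} (f : F ⟶ F') (g : F' ⟶ F'') :
    (f ≫ g).iso = f.iso ≪≫ g.iso := rfl

@[ext]
lemma hom_ext {F F' : TensFun Λ k A M} (f g : F ⟶ F')
    (h : ∀ a, f.iso.hom.app a = g.iso.hom.app a) : f = g :=
  Hom.ext (Iso.ext (NatTrans.ext (funext h)))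

instance isIso {F F' : TensFun Λ k A M} (f : F ⟶ F') : IsIso f :=
  ⟨⟨f.iso.symm, inferInstanceAs (NatTrans.IsMonoidal f.iso.inv)⟩,
    by ext a; simp, by ext a; simp⟩

/-- A monoidal natural isomorphism, as an isomorphism of tensor functors. -/
@[simps]
def isoMk {F F' : TensFun Λ k A M} (e : F.functor ≅ F'.functor) (h : NatTrans.IsMonoidal e.hom) :
    F ≅ F' where
  hom := ⟨e, h⟩
  inv := ⟨e.symm, inferInstanceAs (NatTrans.IsMonoidal e.inv)⟩

/-- Composition of a tensor functor `A ⥤ M` with a tensor functor `M ⥤ N`. -/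
@[simps]
def post (H : M ⥤ N) [H.Braided] [H.Linear Λ] [PreservesColimits H] :
    TensFun Λ k A M ⥤ TensFun Λ k A N where
  obj F :=
    { functor := F.functor ⋙ H
      braided := inferInstance
      map_smul := fun r _ _ f => by simp [F.map_smul]
      colimits := inferInstance }
  map f :=
    { iso := Functor.isoWhiskerRight f.iso H
      monoidal := (inferInstance : NatTrans.IsMonoidal (Functor.whiskerRight f.iso.hom H)) }

/-- Composition of a tensor functor `A ⥤ A` with a tensor functor `A ⥤ M`. -/
@[simps]
def pre (L : A ⥤ A) [L.Braided] [L.Linear k] [L.IsEquivalence] :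
    TensFun Λ k A M ⥤ TensFun Λ k A M where
  obj F :=
    { functor := L ⋙ F.functor
      braided := inferInstance
      map_smul := fun r _ _ f => by simp [F.map_smul]
      colimits := inferInstance }
  map f :=
    { iso := Functor.isoWhiskerLeft L f.iso
      monoidal := (inferInstance : NatTrans.IsMonoidal (Functor.whiskerLeft L f.iso.hom)) }

end TensFun

section Stack

variable {C : Type u₁} [Category.{v₁} C]
variable (Λ : Type w) [CommRing Λ] (k : Type w') [CommRing k] [Algebra Λ k]
  (A : Type u₃) [Category.{v₃} A] [Preadditive A] [Linear k A] [MonoidalCategory A]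
  [SymmetricCategory A]
  (B : FibCat.{v₂, u₂} C) [AbelianTensorFibred B] [LinearFibred Λ B]

/-- Pull-back of tensor functors along `f`. -/
abbrev tensPull {S' S : C} (f : S' ⟶ S) :
    TensFun Λ k A (Fib B S) ⥤ TensFun Λ k A (Fib B S') :=
  TensFun.post (pull B f)

/-- `id^* ≅ id` for tensor functors. -/
def tensPullId {S : C} (f : S ⟶ S) (hf : f = 𝟙 S) : tensPull Λ k A B f ≅ 𝟭 _ :=
  NatIso.ofComponents
    (fun F => TensFun.isoMk
      (Functor.isoWhiskerLeft F.functor (pullId B f hf) ≪≫ F.functor.rightUnitor)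
      (inferInstance : NatTrans.IsMonoidal (Functor.whiskerLeft F.functor (pullId B f hf).hom ≫
        F.functor.rightUnitor.hom)))
    (fun φ => by
      ext a
      exact (congrArg (_ ≫ ·) (Category.comp_id _)).trans
        (((pullId B f hf).hom.naturality (φ.iso.hom.app a)).trans
          (congrArg (· ≫ _) (Category.comp_id _).symm)))

/-- `(f ≫ g)^* ≅ f^* ∘ g^*` for tensor functors. -/
def tensPullComp {S'' S' S : C} (f : S'' ⟶ S') (g : S' ⟶ S) (h : S'' ⟶ S) (w : f ≫ g = h) :
    tensPull Λ k A B h ≅ tensPull Λ k A B g ⋙ tensPull Λ k A B f :=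
  NatIso.ofComponents
    (fun F => TensFun.isoMk
      (Functor.isoWhiskerLeft F.functor (pullComp B f g h w) ≪≫ (Functor.associator _ _ _).symm)
      (inferInstance : NatTrans.IsMonoidal (Functor.whiskerLeft F.functor (pullComp B f g h w).hom
        ≫ (Functor.associator _ _ _).inv)))
    (fun φ => by
      ext a
      exact (congrArg (_ ≫ ·) (Category.comp_id _)).trans
        (((pullComp B f g h w).hom.naturality (φ.iso.hom.app a)).trans
          (congrArg (· ≫ _) (Category.comp_id _).symm)))

lemma tensPullId_hom_app {S : C} (f : S ⟶ S) (hf : f = 𝟙 S) (F : TensFun Λ k A (Fib B S)) (a : A) :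
    ((tensPullId Λ k A B f hf).hom.app F).iso.hom.app a =
      (pullId B f hf).hom.app (F.functor.obj a) :=
  Category.comp_id _

lemma tensPullComp_hom_app {S'' S' S : C} (f : S'' ⟶ S') (g : S' ⟶ S) (h : S'' ⟶ S)
    (w : f ≫ g = h) (F : TensFun Λ k A (Fib B S)) (a : A) :
    ((tensPullComp Λ k A B f g h w).hom.app F).iso.hom.app a =
      (pullComp B f g h w).hom.app (F.functor.obj a) :=
  Category.comp_id _

lemma tensPullComp_inv_app {S'' S' S : C} (f : S'' ⟶ S') (g : S' ⟶ S) (h : S'' ⟶ S)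
    (w : f ≫ g = h) (F : TensFun Λ k A (Fib B S)) (a : A) :
    ((tensPullComp Λ k A B f g h w).inv.app F).iso.hom.app a =
      (pullComp B f g h w).inv.app (F.functor.obj a) :=
  Category.id_comp _

lemma toCatHom_eqToHom_app {E E' : Type u₂} [Category.{v₂} E] [Category.{v₂} E'] (F G : E ⥤ E')
    (h : F.toCatHom = G.toCatHom) (X : E) (h' : F.obj X = G.obj X) :
    eqToHom h' = (eqToHom h).toNatTrans.app X := by
  obtain rfl : F = G := congrArg Cat.Hom.toFunctor h
  rfl

lemma tensPullComp_assoc {S₃ S₂ S₁ S₀ : C} (f : S₃ ⟶ S₂) (g : S₂ ⟶ S₁) (h : S₁ ⟶ S₀)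
    {p q : S₃ ⟶ S₀} (hpq : p = q) (F : TensFun Λ k A (Fib B S₀))
    (hp : f ≫ g ≫ h = p) (hq : (f ≫ g) ≫ h = q) :
    (tensPullComp Λ k A B f (g ≫ h) p hp).hom.app F ≫
      (tensPull Λ k A B f).map ((tensPullComp Λ k A B g h _ rfl).hom.app F) ≫
      𝟙 _ ≫ (tensPullComp Λ k A B f g _ rfl).inv.app ((tensPull Λ k A B h).obj F) ≫
        (tensPullComp Λ k A B (f ≫ g) h q hq).inv.app F = eqToHom (by rw [hpq]) := by
  subst hpq
  rw [eqToHom_refl, Category.id_comp]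
  ext a
  have := pullComp_assoc_eqToHom B f g h (rfl : p = p) (F.functor.obj a) hp hq
  rw [eqToHom_refl, Category.id_comp] at this
  refine Eq.trans ?_ this
  exact congrArg₂ (· ≫ ·) (tensPullComp_hom_app Λ k A B f (g ≫ h) p hp F a)
    (congrArg₂ (· ≫ ·)
      (congrArg (pull B f).map (tensPullComp_hom_app Λ k A B g h _ rfl F a))
      (congrArg₂ (· ≫ ·) (tensPullComp_inv_app Λ k A B f g _ rfl _ a)
        (tensPullComp_inv_app Λ k A B (f ≫ g) h p hq F a)))

lemma tensPull_left_unit {S' S : C} (i : S' ⟶ S') (hi : i = 𝟙 S') (f p : S' ⟶ S) (hp : p = f)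
    (w : i ≫ f = p) (F : TensFun Λ k A (Fib B S)) :
    (tensPullComp Λ k A B i f p w).hom.app F ≫
      (tensPullId Λ k A B i hi).hom.app ((tensPull Λ k A B f).obj F) = eqToHom (by rw [hp]; rfl) := by
  subst hp
  rw [eqToHom_refl]
  ext a
  exact (congrArg₂ (· ≫ ·) (tensPullComp_hom_app Λ k A B i p p w F a)
    (tensPullId_hom_app Λ k A B i hi _ a)).trans (pullComp_id_left B i hi p (F.functor.obj a))

lemma tensPull_right_unit {S' S : C} (i : S ⟶ S) (hi : i = 𝟙 S) (f p : S' ⟶ S) (hp : p = f)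
    (w : f ≫ i = p) (F : TensFun Λ k A (Fib B S)) :
    (tensPullComp Λ k A B f i p w).hom.app F ≫
      (tensPull Λ k A B f).map ((tensPullId Λ k A B i hi).hom.app F) = eqToHom (by rw [hp]; rfl) := by
  subst hp
  rw [eqToHom_refl]
  ext a
  exact (congrArg₂ (· ≫ ·) (tensPullComp_hom_app Λ k A B p i p w F a)
    (congrArg (pull B p).map (tensPullId_hom_app Λ k A B i hi _ a))).trans
      (pullComp_id_right B i hi p (F.functor.obj a))

/-- The fibred category `\uline A(B)` of tensor functors from `A` to the fibres of `B`; its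
morphisms over an identity are the monoidal natural isomorphisms. -/
def tensStack : FibCat C :=
  LocallyDiscrete.mkPseudofunctor
    (fun S => Cat.of (TensFun Λ k A (Fib B S.unop)))
    (fun f => (tensPull Λ k A B f.unop).toCatHom)
    (fun S => Cat.Hom.isoMk (tensPullId Λ k A B (𝟙 S.unop) rfl))
    (fun f g => Cat.Hom.isoMk (tensPullComp Λ k A B g.unop f.unop _ rfl))
    (fun f g h => Cat.Hom₂.ext (NatTrans.ext (funext fun F =>
      (tensPullComp_assoc Λ k A B h.unop g.unop f.unop (Category.assoc _ _ _).symm F rfl rfl).trans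
        (toCatHom_eqToHom_app _ _ _ F _))))
    (fun f => Cat.Hom₂.ext (NatTrans.ext (funext fun F => by
      refine Eq.trans ?_ ((tensPull_right_unit Λ k A B (𝟙 _) rfl f.unop _ (Category.comp_id _) rfl F).trans
        (toCatHom_eqToHom_app _ _ _ F _))
      exact congrArg (_ ≫ ·) (Category.comp_id _))))
    (fun f => Cat.Hom₂.ext (NatTrans.ext (funext fun F => by
      refine Eq.trans ?_ ((tensPull_left_unit Λ k A B (𝟙 _) rfl f.unop _ (Category.id_comp _) rfl F).trans
        (toCatHom_eqToHom_app (tensPull Λ k A B (𝟙 _ ≫ f.unop)) (tensPull Λ k A B f.unop) _ F _))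
      exact congrArg (_ ≫ ·) (Category.comp_id _))))

end Stack

end TensFun


section FibHom

variable {E : Type u₁} [Category.{v₁} E] {E' : Type u₅} [Category.{v₅} E']
  {C : Type u₂} [Category.{v₂} C] {D : Type u₃} [Category.{v₃} D] {D' : Type u₄} [Category.{v₄} D']

/-- A morphism `P⁻¹ X ⟶ Q⁻¹ Y` of fibred categories over `E`, where `P : E ⥤ C`, `Q : E ⥤ D` and
`X`, `Y` are fibred categories over `C` and `D`: functors between the fibres which commute with
pull-backs up to coherent isomorphism. -/
structure FibHom (P : E ⥤ C) (X : FibCat.{v', u'} C) (Q : E ⥤ D) (Y : FibCat.{v'', u''} D) where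
  /-- the functors on fibres -/
  app (S : E) : Fib X (P.obj S) ⥤ Fib Y (Q.obj S)
  /-- the compatibility with pull-backs -/
  iso {S' S : E} (f : S' ⟶ S) : pull X (P.map f) ⋙ app S' ≅ app S ⋙ pull Y (Q.map f)
  iso_id (S : E) (x : Fib X (P.obj S)) :
    (iso (𝟙 S)).hom.app x ≫ (pullId Y (Q.map (𝟙 S))).hom.app ((app S).obj x) =
      (app S).map ((pullId X (P.map (𝟙 S))).hom.app x)
  iso_comp {S'' S' S : E} (f : S'' ⟶ S') (g : S' ⟶ S) (x : Fib X (P.obj S)) :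
    (iso (f ≫ g)).hom.app x ≫
        (pullComp Y (Q.map f) (Q.map g) (Q.map (f ≫ g))).hom.app ((app S).obj x) =
      (app S'').map ((pullComp X (P.map f) (P.map g) (P.map (f ≫ g))).hom.app x) ≫
        (iso f).hom.app ((pull X (P.map g)).obj x) ≫ (pull Y (Q.map f)).map ((iso g).hom.app x)

namespace FibHom

variable {P : E ⥤ C} {X : FibCat.{v', u'} C} {Q : E ⥤ D} {Y : FibCat.{v'', u''} D}
  {Q' : E ⥤ D'} {Z : FibCat.{v''', u'''} D'}

/-- A morphism of fibred categories is an equivalence if it is one on every fibre. -/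
def IsEquiv (Φ : FibHom P X Q Y) : Prop := ∀ S, (Φ.app S).IsEquivalence

/-- The restriction of a morphism of fibred categories along a functor `R : E' ⥤ E`. -/
def along (R : E' ⥤ E) (Φ : FibHom P X Q Y) : FibHom (R ⋙ P) X (R ⋙ Q) Y where
  app S := Φ.app (R.obj S)
  iso f := Φ.iso (R.map f)
  iso_id S x := by
    have key : ∀ (i : R.obj S ⟶ R.obj S) (hi : i = 𝟙 _),
        (Φ.iso i).hom.app x ≫ (pullId Y (Q.map i)).hom.app ((Φ.app _).obj x) =
          (Φ.app _).map ((pullId X (P.map i)).hom.app x) := by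
      rintro i rfl
      exact Φ.iso_id _ x
    exact key _ (R.map_id S)
  iso_comp {S'' S' S} f g x := by
    have key : ∀ (h : R.obj S'' ⟶ R.obj S) (hh : h = R.map f ≫ R.map g),
        (Φ.iso h).hom.app x ≫
          (pullComp Y (Q.map (R.map f)) (Q.map (R.map g)) (Q.map h)).hom.app ((Φ.app _).obj x) =
        (Φ.app _).map ((pullComp X (P.map (R.map f)) (P.map (R.map g)) (P.map h)).hom.app x) ≫
          (Φ.iso (R.map f)).hom.app ((pull X (P.map (R.map g))).obj x) ≫
            (pull Y (Q.map (R.map f))).map ((Φ.iso (R.map g)).hom.app x) := by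
      rintro h rfl
      exact Φ.iso_comp _ _ x
    exact key _ (R.map_comp f g)

/-- The composition of morphisms of fibred categories. -/
def comp (Φ : FibHom P X Q Y) (Ψ : FibHom Q Y Q' Z) : FibHom P X Q' Z where
  app S := Φ.app S ⋙ Ψ.app S
  iso {S' S} f := (Functor.associator _ _ _).symm ≪≫ Functor.isoWhiskerRight (Φ.iso f) (Ψ.app S') ≪≫
    Functor.associator _ _ _ ≪≫ Functor.isoWhiskerLeft (Φ.app S) (Ψ.iso f) ≪≫
    (Functor.associator _ _ _).symm
  iso_id S x := by
    have h1 := Φ.iso_id S x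
    have h2 := Ψ.iso_id S ((Φ.app S).obj x)
    simp only [Iso.trans_hom, Iso.symm_hom, NatTrans.comp_app, Functor.associator_inv_app,
      Functor.associator_hom_app, Functor.isoWhiskerRight_hom, Functor.isoWhiskerLeft_hom,
      Functor.whiskerRight_app, Functor.whiskerLeft_app, Category.id_comp, Category.comp_id,
      Category.assoc, Functor.comp_obj, Functor.comp_map] at *
    rw [h2, ← Functor.map_comp, h1]
  iso_comp {S'' S' S} f g x := by
    have h1 := Φ.iso_comp f g x
    have h2 := Ψ.iso_comp f g ((Φ.app S).obj x)
    have h3 := (Ψ.iso f).hom.naturality ((Φ.iso g).hom.app x)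
    simp only [Iso.trans_hom, Iso.symm_hom, NatTrans.comp_app, Functor.associator_inv_app,
      Functor.associator_hom_app, Functor.isoWhiskerRight_hom, Functor.isoWhiskerLeft_hom,
      Functor.whiskerRight_app, Functor.whiskerLeft_app, Category.id_comp, Category.comp_id,
      Category.assoc, Functor.comp_obj, Functor.comp_map, Functor.map_comp] at *
    rw [h2, ← Functor.map_comp_assoc, h1]
    simp only [Functor.map_comp, Category.assoc]
    rw [reassoc_of% h3]

lemma comp_iso_hom_app (Φ : FibHom P X Q Y) (Ψ : FibHom Q Y Q' Z) {S' S : E} (f : S' ⟶ S)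
    (x : Fib X (P.obj S)) :
    ((Φ.comp Ψ).iso f).hom.app x =
      (Ψ.app S').map ((Φ.iso f).hom.app x) ≫ (Ψ.iso f).hom.app ((Φ.app S).obj x) := by
  simp [comp]

end FibHom

/-- Natural isomorphisms between morphisms of fibred categories. -/
structure FibIso {P : E ⥤ C} {X : FibCat.{v', u'} C} {Q : E ⥤ D} {Y : FibCat.{v'', u''} D}
    (Φ Ψ : FibHom P X Q Y) where
  /-- the natural isomorphisms on fibres -/
  app (S : E) : Φ.app S ≅ Ψ.app S
  naturality {S' S : E} (f : S' ⟶ S) (x : Fib X (P.obj S)) :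
    (Φ.iso f).hom.app x ≫ (pull Y (Q.map f)).map ((app S).hom.app x) =
      (app S').hom.app ((pull X (P.map f)).obj x) ≫ (Ψ.iso f).hom.app x

end FibHom

section Slices

variable {C : Type u₁} [Category.{v₁} C]

/-- An object of `C` over both `T₁` and `T₂`. As `C` has a terminal object `S₀` in the application,
these are the objects over `T₁ ×_{S₀} T₂`. -/
structure Over2 (T₁ T₂ : C) where
  /-- the object -/
  pt : C
  /-- the map to `T₁` -/
  a₁ : pt ⟶ T₁
  /-- the map to `T₂` -/
  a₂ : pt ⟶ T₂

/-- An object of `C` over `T₁`, `T₂` and `T₃`, that is, over `T₁ ×_{S₀} T₂ ×_{S₀} T₃`. -/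
structure Over3 (T₁ T₂ T₃ : C) where
  /-- the object -/
  pt : C
  /-- the map to `T₁` -/
  a₁ : pt ⟶ T₁
  /-- the map to `T₂` -/
  a₂ : pt ⟶ T₂
  /-- the map to `T₃` -/
  a₃ : pt ⟶ T₃

namespace Over2

variable {T₁ T₂ : C}

/-- Morphisms over `T₁` and `T₂`. -/
@[ext]
structure Hom (s t : Over2 T₁ T₂) where
  /-- the morphism -/
  f : s.pt ⟶ t.pt
  w₁ : f ≫ t.a₁ = s.a₁
  w₂ : f ≫ t.a₂ = s.a₂

/-- The category `C / (T₁ ×_{S₀} T₂)`. -/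
instance category : Category (Over2 T₁ T₂) where
  Hom := Hom
  id s := ⟨𝟙 s.pt, Category.id_comp _, Category.id_comp _⟩
  comp u v := ⟨u.f ≫ v.f, by rw [Category.assoc, v.w₁, u.w₁], by rw [Category.assoc, v.w₂, u.w₂]⟩
  id_comp u := Hom.ext (Category.id_comp _)
  comp_id u := Hom.ext (Category.comp_id _)
  assoc u v w := Hom.ext (Category.assoc _ _ _)

variable (T₁ T₂)

/-- The first projection. -/
def fst : Over2 T₁ T₂ ⥤ Over T₁ where
  obj s := Over.mk s.a₁
  map u := Over.homMk u.f u.w₁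

/-- The second projection. -/
def snd : Over2 T₁ T₂ ⥤ Over T₂ where
  obj s := Over.mk s.a₂
  map u := Over.homMk u.f u.w₂

end Over2

namespace Over3

variable {T₁ T₂ T₃ : C}

/-- Morphisms over `T₁`, `T₂` and `T₃`. -/
@[ext]
structure Hom (s t : Over3 T₁ T₂ T₃) where
  /-- the morphism -/
  f : s.pt ⟶ t.pt
  w₁ : f ≫ t.a₁ = s.a₁
  w₂ : f ≫ t.a₂ = s.a₂
  w₃ : f ≫ t.a₃ = s.a₃

/-- The category `C / (T₁ ×_{S₀} T₂ ×_{S₀} T₃)`. -/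
instance category : Category (Over3 T₁ T₂ T₃) where
  Hom := Hom
  id s := ⟨𝟙 s.pt, Category.id_comp _, Category.id_comp _, Category.id_comp _⟩
  comp u v := ⟨u.f ≫ v.f, by rw [Category.assoc, v.w₁, u.w₁], by rw [Category.assoc, v.w₂, u.w₂],
    by rw [Category.assoc, v.w₃, u.w₃]⟩
  id_comp u := Hom.ext (Category.id_comp _)
  comp_id u := Hom.ext (Category.comp_id _)
  assoc u v w := Hom.ext (Category.assoc _ _ _)

variable (T₁ T₂ T₃)

/-- The projection to the first two factors. -/
def p12 : Over3 T₁ T₂ T₃ ⥤ Over2 T₁ T₂ where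
  obj s := ⟨s.pt, s.a₁, s.a₂⟩
  map u := ⟨u.f, u.w₁, u.w₂⟩

/-- The projection to the last two factors. -/
def p23 : Over3 T₁ T₂ T₃ ⥤ Over2 T₂ T₃ where
  obj s := ⟨s.pt, s.a₂, s.a₃⟩
  map u := ⟨u.f, u.w₂, u.w₃⟩

/-- The projection to the first and the last factor. -/
def p13 : Over3 T₁ T₂ T₃ ⥤ Over2 T₁ T₃ where
  obj s := ⟨s.pt, s.a₁, s.a₃⟩
  map u := ⟨u.f, u.w₁, u.w₃⟩

end Over3

end Slices

section Descent

variable {C : Type u₁} [Category.{v₁} C]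

/-- A stack (in groupoids): a fibred category whose fibres are groupoids and for which descent is
effective. -/
structure IsGroupoidStack (J : GrothendieckTopology C) (X : FibCat.{v', u'} C) : Prop where
  isStack : X.IsStack J
  isIso {S : C} {x y : Fib X S} (f : x ⟶ y) : IsIso f

variable {ι : Type w} (T : ι → C)

/-- The data `(X_i, χ_ij, φ_ijk)` entering in a `2`-descent datum: fibred categories `X_i` over
`C / T_i`, morphisms `χ_ij : X_i|_ij ⟶ X_j|_ij` over `C / T_ij` and natural isomorphisms
`φ_ijk : χ_jk ∘ χ_ij ⟹ χ_ik` over `C / T_ijk`. -/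
structure TwoDescentData where
  /-- the fibred categories `X_i` -/
  X (i : ι) : FibCat.{v', u'} (Over (T i))
  /-- the morphisms `χ_ij` -/
  χ (i j : ι) : FibHom (Over2.fst (T i) (T j)) (X i) (Over2.snd (T i) (T j)) (X j)
  /-- the natural isomorphisms `φ_ijk` -/
  φ (i j l : ι) :
    FibIso (((χ i j).along (Over3.p12 (T i) (T j) (T l))).comp
      ((χ j l).along (Over3.p23 (T i) (T j) (T l)))) ((χ i l).along (Over3.p13 (T i) (T j) (T l)))

variable {T}

/-- The data `(X_i, χ_ij, φ_ijk)` are a `2`-descent datum of stacks: the `X_i` are stacks, the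
`χ_ij` are equivalences, and the two natural isomorphisms `χ_lm ∘ χ_jl ∘ χ_ij ⟹ χ_im` over
`T_ijlm` that are obtained from the `φ`'s agree. -/
structure TwoDescentData.IsTwoDescentDatum (J : GrothendieckTopology C)
    (𝒟 : TwoDescentData.{v', u'} T) : Prop where
  isStack (i : ι) : IsGroupoidStack (J.over (T i)) (𝒟.X i)
  isEquiv (i j : ι) : (𝒟.χ i j).IsEquiv
  tetrahedron (i j l m : ι) (S : C) (a : S ⟶ T i) (b : S ⟶ T j) (c : S ⟶ T l) (d : S ⟶ T m)
    (x : Fib (𝒟.X i) (Over.mk a)) :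
    ((𝒟.χ l m).app ⟨S, c, d⟩).map (((𝒟.φ i j l).app ⟨S, a, b, c⟩).hom.app x) ≫
        ((𝒟.φ i l m).app ⟨S, a, c, d⟩).hom.app x =
      ((𝒟.φ j l m).app ⟨S, b, c, d⟩).hom.app (((𝒟.χ i j).app ⟨S, a, b⟩).obj x) ≫
        ((𝒟.φ i j m).app ⟨S, a, b, d⟩).hom.app x

/-- `Y` is obtained by gluing the `X_i` along the `χ_ij` and `φ_ijk`: there are equivalences
`ψ_i : Y|_{T_i} ⟶ X_i` and natural isomorphisms `θ_ij : χ_ij ∘ ψ_i ⟹ ψ_j` over `C / T_ij`, such that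
the two natural isomorphisms `χ_jl ∘ χ_ij ∘ ψ_i ⟹ ψ_l` over `C / T_ijl` agree. -/
structure TwoDescentData.Gluing (𝒟 : TwoDescentData.{v', u'} T) (Y : FibCat.{v'', u''} C) where
  /-- the equivalences `ψ_i` -/
  ψ (i : ι) : FibHom (Over.forget (T i)) Y (𝟭 (Over (T i))) (𝒟.X i)
  isEquiv (i : ι) : (ψ i).IsEquiv
  /-- the natural isomorphisms `θ_ij` -/
  θ (i j : ι) : FibIso (((ψ i).along (Over2.fst (T i) (T j))).comp (𝒟.χ i j))
    ((ψ j).along (Over2.snd (T i) (T j)))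
  compat (i j l : ι) (S : C) (a : S ⟶ T i) (b : S ⟶ T j) (c : S ⟶ T l) (y : Fib Y S) :
    ((𝒟.χ j l).app ⟨S, b, c⟩).map (((θ i j).app ⟨S, a, b⟩).hom.app y) ≫
        ((θ j l).app ⟨S, b, c⟩).hom.app y =
      ((𝒟.φ i j l).app ⟨S, a, b, c⟩).hom.app (((ψ i).app (Over.mk a)).obj y) ≫
        ((θ i l).app ⟨S, a, c⟩).hom.app y

end Descent

section TensDatum

variable {C : Type u₁} [Category.{v₁} C]
variable (Λ : Type w) [CommRing Λ] (k : Type w') [CommRing k] [Algebra Λ k]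
  (A : Type u₃) [Category.{v₃} A] [Preadditive A] [Linear k A] [MonoidalCategory A]
  [SymmetricCategory A]
  (B : FibCat.{v₂, u₂} C) [AbelianTensorFibred B] [LinearFibred Λ B]

lemma pullId_tensStack {S : C} (f : S ⟶ S) (hf : f = 𝟙 S) :
    pullId (tensStack Λ k A B) f hf = tensPullId Λ k A B f hf := by
  subst hf
  exact congrArg Cat.Hom.toNatIso (Pseudofunctor.mapId'_eq_mapId (tensStack Λ k A B) _)

lemma pullComp_tensStack {S'' S' S : C} (f : S'' ⟶ S') (g : S' ⟶ S) (h : S'' ⟶ S)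
    (w : f ≫ g = h) :
    pullComp (tensStack Λ k A B) f g h w = tensPullComp Λ k A B f g h w := by
  subst w
  exact congrArg Cat.Hom.toNatIso
    (Pseudofunctor.mapComp'_eq_mapComp (tensStack Λ k A B) g.op.toLoc f.op.toLoc)

lemma tensPullId_restr {D : Type u₄} [Category.{v₄} D] (P : D ⥤ C) {S : D} (f : S ⟶ S)
    (hf : f = 𝟙 S) :
    tensPullId Λ k A (restr P B) f hf = tensPullId Λ k A B (P.map f) (by rw [hf, P.map_id]) := by
  refine Iso.ext (NatTrans.ext (funext fun F => TensFun.hom_ext _ _ fun a => ?_))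
  refine (tensPullId_hom_app Λ k A (restr P B) f hf F a).trans ?_
  rw [pullId_restr]
  exact (tensPullId_hom_app Λ k A B (P.map f) _ F a).symm

lemma tensPullComp_restr {D : Type u₄} [Category.{v₄} D] (P : D ⥤ C) {S'' S' S : D} (f : S'' ⟶ S')
    (g : S' ⟶ S) (h : S'' ⟶ S) (w : f ≫ g = h) :
    tensPullComp Λ k A (restr P B) f g h w =
      tensPullComp Λ k A B (P.map f) (P.map g) (P.map h) (by rw [← w, P.map_comp]) := by
  refine Iso.ext (NatTrans.ext (funext fun F => TensFun.hom_ext _ _ fun a => ?_))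
  refine (tensPullComp_hom_app Λ k A (restr P B) f g h w F a).trans ?_
  rw [pullComp_restr]
  exact (tensPullComp_hom_app Λ k A B (P.map f) (P.map g) (P.map h) _ F a).symm

/-- The stack `\uline A(B_{/T})` over `C / T`. -/
abbrev tensSlice (T : C) : FibCat (Over T) :=
  tensStack Λ k A (restr (Over.forget T) B)

/-- `L^*` commutes with pull-backs. -/
def preIso (L : A ⥤ A) [L.Braided] [L.Linear k] [L.IsEquivalence] {S' S : C} (f : S' ⟶ S) :
    tensPull Λ k A B f ⋙ TensFun.pre L ≅ TensFun.pre L ⋙ tensPull Λ k A B f :=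
  NatIso.ofComponents (fun F => TensFun.isoMk
    (Functor.associator L F.functor (pull B f)).symm
    (inferInstance : NatTrans.IsMonoidal (Functor.associator L F.functor (pull B f)).inv))
    (fun φ => by
      ext a
      exact (Category.comp_id _).trans (Category.id_comp _).symm)

lemma preIso_hom_app (L : A ⥤ A) [L.Braided] [L.Linear k] [L.IsEquivalence] {S' S : C}
    (f : S' ⟶ S) (F : TensFun Λ k A (Fib B S)) (a : A) :
    ((preIso Λ k A B L f).hom.app F).iso.hom.app a = 𝟙 _ := rfl

lemma preIso_id (L : A ⥤ A) [L.Braided] [L.Linear k] [L.IsEquivalence] {S : C} (i : S ⟶ S)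
    (hi hi' : i = 𝟙 S) (F : TensFun Λ k A (Fib B S)) :
    (preIso Λ k A B L i).hom.app F ≫ (tensPullId Λ k A B i hi).hom.app ((TensFun.pre L).obj F) =
      (TensFun.pre L).map ((tensPullId Λ k A B i hi').hom.app F) := by
  ext a
  exact (congrArg₂ (· ≫ ·) (preIso_hom_app Λ k A B L i F a)
    (tensPullId_hom_app Λ k A B i hi _ a)).trans
      ((Category.id_comp _).trans (tensPullId_hom_app Λ k A B i hi' F (L.obj a)).symm)

lemma preIso_comp (L : A ⥤ A) [L.Braided] [L.Linear k] [L.IsEquivalence] {S'' S' S : C}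
    (f : S'' ⟶ S') (g : S' ⟶ S) (h : S'' ⟶ S) (w w' : f ≫ g = h) (F : TensFun Λ k A (Fib B S)) :
    (preIso Λ k A B L h).hom.app F ≫
        (tensPullComp Λ k A B f g h w).hom.app ((TensFun.pre L).obj F) =
      (TensFun.pre L).map ((tensPullComp Λ k A B f g h w').hom.app F) ≫
        (preIso Λ k A B L f).hom.app ((tensPull Λ k A B g).obj F) ≫
          (tensPull Λ k A B f).map ((preIso Λ k A B L g).hom.app F) := by
  ext a
  have e1 := tensPullComp_hom_app Λ k A B f g h w ((TensFun.pre L).obj F) a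
  have e2 := tensPullComp_hom_app Λ k A B f g h w' F (L.obj a)
  refine (congrArg₂ (· ≫ ·) (preIso_hom_app Λ k A B L h F a) e1).trans
    ((Category.id_comp _).trans (Eq.symm ?_))
  refine (congrArg₂ (· ≫ ·) e2 (congrArg₂ (· ≫ ·)
    (preIso_hom_app Λ k A B L f ((tensPull Λ k A B g).obj F) a)
    (congrArg (pull B f).map (preIso_hom_app Λ k A B L g F a)))).trans ?_
  refine (congrArg (_ ≫ ·) ((Category.id_comp _).trans ((pull B f).map_id _))).trans ?_
  exact Category.comp_id _

/-- The morphism `L^* : \uline A(B_{/T₁})|_{12} ⟶ \uline A(B_{/T₂})|_{12}`, `F ↦ F ∘ L`. -/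
def preHom (T₁ T₂ : C) (L : A ⥤ A) [L.Braided] [L.Linear k] [L.IsEquivalence] :
    FibHom (Over2.fst T₁ T₂) (tensSlice Λ k A B T₁) (Over2.snd T₁ T₂) (tensSlice Λ k A B T₂) where
  app S := (TensFun.pre L : TensFun Λ k A (Fib B S.pt) ⥤ TensFun Λ k A (Fib B S.pt))
  iso {S' S} f := preIso Λ k A B L f.f
  iso_id S x := by
    rw [pullId_tensStack, pullId_tensStack, tensPullId_restr, tensPullId_restr]
    exact preIso_id Λ k A B L _ _ _ x
  iso_comp f g x := by
    rw [pullComp_tensStack, pullComp_tensStack, tensPullComp_restr, tensPullComp_restr]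
    exact preIso_comp Λ k A B L f.f g.f _ _ _ x

/-- The natural isomorphism `F ∘ L₁ ∘ L₂ ≅ F ∘ L₃` of tensor functors given by
`μ : L₁ ∘ L₂ ≅ L₃`. -/
def preMu {M : Type u₂} [Category.{v₂} M] [Preadditive M] [Linear Λ M] [MonoidalCategory M]
    [SymmetricCategory M] (L₁ L₂ L₃ : A ⥤ A)
    [L₁.Braided] [L₁.Linear k] [L₁.IsEquivalence] [L₂.Braided] [L₂.Linear k] [L₂.IsEquivalence]
    [L₃.Braided] [L₃.Linear k] [L₃.IsEquivalence] (μ : L₂ ⋙ L₁ ≅ L₃) [NatTrans.IsMonoidal μ.hom] :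
    TensFun.pre L₁ ⋙ TensFun.pre L₂ ≅
      (TensFun.pre L₃ : TensFun Λ k A M ⥤ TensFun Λ k A M) :=
  NatIso.ofComponents (fun F => TensFun.isoMk
    ((Functor.associator L₂ L₁ F.functor).symm ≪≫ Functor.isoWhiskerRight μ F.functor)
    (inferInstance : NatTrans.IsMonoidal ((Functor.associator L₂ L₁ F.functor).inv ≫
      Functor.whiskerRight μ.hom F.functor)))
    (fun {F F'} φ => by
      ext a
      exact (congrArg (_ ≫ ·) (Category.id_comp _)).trans
        ((φ.iso.hom.naturality (μ.hom.app a)).symm.trans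
          (congrArg (· ≫ _) (Category.id_comp _).symm)))

lemma preMu_hom_app {M : Type u₂} [Category.{v₂} M] [Preadditive M] [Linear Λ M]
    [MonoidalCategory M] [SymmetricCategory M] (L₁ L₂ L₃ : A ⥤ A)
    [L₁.Braided] [L₁.Linear k] [L₁.IsEquivalence] [L₂.Braided] [L₂.Linear k] [L₂.IsEquivalence]
    [L₃.Braided] [L₃.Linear k] [L₃.IsEquivalence] (μ : L₂ ⋙ L₁ ≅ L₃) [NatTrans.IsMonoidal μ.hom]
    (F : TensFun Λ k A M) (a : A) :
    ((preMu Λ k A L₁ L₂ L₃ μ).hom.app F).iso.hom.app a = F.functor.map (μ.hom.app a) :=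
  Category.id_comp _

lemma preMu_naturality (L₁ L₂ L₃ : A ⥤ A)
    [L₁.Braided] [L₁.Linear k] [L₁.IsEquivalence] [L₂.Braided] [L₂.Linear k] [L₂.IsEquivalence]
    [L₃.Braided] [L₃.Linear k] [L₃.IsEquivalence] (μ : L₂ ⋙ L₁ ≅ L₃) [NatTrans.IsMonoidal μ.hom]
    {S' S : C} (f : S' ⟶ S) (F : TensFun Λ k A (Fib B S)) :
    ((TensFun.pre L₂).map ((preIso Λ k A B L₁ f).hom.app F) ≫
      (preIso Λ k A B L₂ f).hom.app ((TensFun.pre L₁).obj F)) ≫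
        (tensPull Λ k A B f).map ((preMu Λ k A L₁ L₂ L₃ μ).hom.app F) =
    (preMu Λ k A L₁ L₂ L₃ μ).hom.app ((tensPull Λ k A B f).obj F) ≫
      (preIso Λ k A B L₃ f).hom.app F := by
  ext a
  refine (congrArg₂ (· ≫ ·) ((congrArg₂ (· ≫ ·) (preIso_hom_app Λ k A B L₁ f F (L₂.obj a))
    (preIso_hom_app Λ k A B L₂ f _ a)).trans (Category.id_comp _))
    (congrArg (pull B f).map (preMu_hom_app Λ k A L₁ L₂ L₃ μ F a))).trans ((Category.id_comp _).trans
      (Eq.symm ?_))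
  exact (congrArg₂ (· ≫ ·) (preMu_hom_app Λ k A L₁ L₂ L₃ μ _ a)
    (preIso_hom_app Λ k A B L₃ f F a)).trans (Category.comp_id _)

variable {ι : Type w''} (T : ι → C)

/-- The data `(\uline A(B_{/T_i}), λ_ij^*, μ_ijl)` associated with tensor autoequivalences `λ_ij` of
`A` (with tensor structures `t_ij`) and monoidal natural isomorphisms
`μ_ijl : λ_ij ∘ λ_jl ⟹ λ_il`. -/
def tensData (L : ι → ι → A ⥤ A) [∀ i j, (L i j).Linear k] [∀ i j, (L i j).IsEquivalence]
    (t : ∀ i j, (L i j).Braided) (μ : ∀ i j l, L j l ⋙ L i j ≅ L i l)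
    (hμ : ∀ i j l, NatTrans.IsMonoidal (μ i j l).hom) : TwoDescentData T where
  X i := tensSlice Λ k A B (T i)
  χ i j := preHom Λ k A B (T i) (T j) (L i j)
  φ i j l :=
    { app := fun S => preMu Λ k A (M := Fib B S.pt) (L i j) (L j l) (L i l) (μ i j l)
      naturality := fun {S' S} f x => by
        exact (congrArg (· ≫ _) (FibHom.comp_iso_hom_app _ _ f x)).trans
          (preMu_naturality Λ k A B (L i j) (L j l) (L i l) (μ i j l) f.f x) }

end TensDatum
section Spec

variable {C : Type u₁} [Category.{v₁} C]
variable (Λ : Type w) [CommRing Λ]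
variable (B : FibCat.{v₂, u₂} C) [AbelianTensorFibred B] [LinearFibred Λ B]

instance pull_additive {S' S : C} (f : S' ⟶ S) : (pull B f).Additive := by
  have := preservesBinaryBiproducts_of_preservesBinaryCoproducts (pull B f)
  exact Functor.additive_of_preservesBinaryBiproducts (pull B f)

/-- The restriction `f^* : O(S) ⟶ O(S')` of functions, where `O(S)` is the endomorphism ring of the
unit object of `B_S`. -/
def pullEnd {S' S : C} (f : S' ⟶ S) : End (𝟙_ (Fib B S)) →ₐ[Λ] End (𝟙_ (Fib B S')) where
  toFun e := Functor.LaxMonoidal.ε (pull B f) ≫ (pull B f).map e ≫ Functor.OplaxMonoidal.η (pull B f)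
  map_one' := by
    simp [End.one_def]
  map_mul' e e' := by
    simp [End.mul_def]
  map_zero' := by
    change _ ≫ (pull B f).map (0 : 𝟙_ (Fib B S) ⟶ 𝟙_ (Fib B S)) ≫ _ = (0 : 𝟙_ (Fib B S') ⟶ _)
    rw [(pull B f).map_zero, zero_comp, comp_zero]
  map_add' e e' := by
    change _ ≫ (pull B f).map ((e : 𝟙_ (Fib B S) ⟶ 𝟙_ (Fib B S)) + e') ≫ _ = _ + _
    rw [(pull B f).map_add, Preadditive.add_comp, Preadditive.comp_add]
  commutes' r := by
    rw [Algebra.algebraMap_eq_smul_one, Algebra.algebraMap_eq_smul_one]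
    change _ ≫ (pull B f).map (r • 𝟙 (𝟙_ (Fib B S)) : 𝟙_ (Fib B S) ⟶ 𝟙_ (Fib B S)) ≫ _ =
      (r • 𝟙 (𝟙_ (Fib B S')) : 𝟙_ (Fib B S') ⟶ 𝟙_ (Fib B S'))
    simp

lemma pullEnd_id {S : C} (e : End (𝟙_ (Fib B S))) : pullEnd Λ B (𝟙 S) e = e := by
  have h := (pullId B (𝟙 S) rfl).hom.naturality e
  have h' := NatTrans.IsMonoidal.unit (τ := (pullId B (𝟙 S) rfl).hom)
  change Functor.LaxMonoidal.ε (pull B (𝟙 S)) ≫ (pull B (𝟙 S)).map e ≫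
    Functor.OplaxMonoidal.η (pull B (𝟙 S)) = (e : 𝟙_ (Fib B S) ⟶ _)
  rw [← cancel_mono (Functor.LaxMonoidal.ε (pull B (𝟙 S)))]
  rw [← cancel_mono ((pullId B (𝟙 S) rfl).hom.app _)]
  simp only [Category.assoc, Functor.Monoidal.η_ε, Category.comp_id, h', h]
  rw [reassoc_of% h']
  simp

lemma pullEnd_comp {S'' S' S : C} (f : S'' ⟶ S') (g : S' ⟶ S) (e : End (𝟙_ (Fib B S))) :
    pullEnd Λ B (f ≫ g) e = pullEnd Λ B f (pullEnd Λ B g e) := by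
  have h := (pullComp B f g (f ≫ g) rfl).hom.naturality e
  have h' := NatTrans.IsMonoidal.unit (τ := (pullComp B f g (f ≫ g) rfl).hom)
  change Functor.LaxMonoidal.ε (pull B (f ≫ g)) ≫ (pull B (f ≫ g)).map e ≫
    Functor.OplaxMonoidal.η (pull B (f ≫ g)) =
      Functor.LaxMonoidal.ε (pull B f) ≫ (pull B f).map (Functor.LaxMonoidal.ε (pull B g) ≫
        (pull B g).map e ≫ Functor.OplaxMonoidal.η (pull B g)) ≫ Functor.OplaxMonoidal.η (pull B f)
  rw [← cancel_mono (Functor.LaxMonoidal.ε (pull B (f ≫ g)))]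
  rw [← cancel_mono ((pullComp B f g (f ≫ g) rfl).hom.app _)]
  simp only [Category.assoc, Functor.Monoidal.η_ε, Category.comp_id, h', h]
  rw [reassoc_of% h']
  simp

variable (R : Type w') [CommRing R] [Algebra Λ R]

/-- The functor of points `S ↦ Hom_Λ(R, O(S))` of the affine scheme `Spec R` over `Λ`. -/
def specPresheaf : Cᵒᵖ ⥤ Type (max w' v₂) where
  obj S := R →ₐ[Λ] End (𝟙_ (Fib B S.unop))
  map f := ↾fun x => (pullEnd Λ B f.unop).comp x
  map_id S := by
    refine ConcreteCategory.hom_ext _ _ fun x => ?_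
    exact (AlgHom.ext fun r => pullEnd_id Λ B (x r) : (pullEnd Λ B (𝟙 S.unop)).comp x = x)
  map_comp f g := by
    refine ConcreteCategory.hom_ext _ _ fun x => ?_
    exact (AlgHom.ext fun r => pullEnd_comp Λ B g.unop f.unop (x r) :
      (pullEnd Λ B (g.unop ≫ f.unop)).comp x =
        (pullEnd Λ B g.unop).comp ((pullEnd Λ B f.unop).comp x))

/-- `Spec R`, as a category fibred in sets. -/
def specFib : FibCat.{max w' v₂, max w' v₂} C :=
  (specPresheaf Λ B R ⋙ typeToCat).toPseudofunctor'

end Spec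

section Dual

variable {C : Type u₁} [Category.{v₁} C]
variable (Λ : Type w) [CommRing Λ] {k G : Type u} [Field k] [IsAlgClosed k] [CharZero k]
  [Algebra Λ k] [Group G] [Finite G]
  (B : FibCat.{v₂, u₂} C) [AbelianTensorFibred B] [LinearFibred Λ B]
  {ι : Type w'} (T : ι → C) (α : ι → ι → G ≃* G)

/-- The condition that natural isomorphisms `μ_ijl : λ'_ij ∘ λ'_jl ⟹ λ'_il`, `λ'_ij = κ'(α_ij)`, are
monoidal with respect to the tensor structures `t_ij` on the functors `λ'_ij`. -/
def IsTensorFamily (t : ∀ i j, (resZ (k := k) (α i j)).Braided)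
    (μ : ∀ i j l, resZ (α j l) ⋙ resZ (α i j) ≅ resZ (k := k) (α i l)) : Prop :=
  ∀ i j l, NatTrans.IsMonoidal (μ i j l).hom

/-- The data `(\uline{A_Z}(B_{/T_i}), λ'_ij, μ'_ijl)`, where `A_Z = (Rep G, ⊗_Z)` and
`λ'_ij = κ'(α_ij)`. -/
def dualData (t : ∀ i j, (resZ (k := k) (α i j)).Braided)
    (μ : ∀ i j l, resZ (α j l) ⋙ resZ (α i j) ≅ resZ (k := k) (α i l))
    (hμ : IsTensorFamily α t μ) : TwoDescentData T :=
  tensData Λ k (RepZ k G) B T (fun i j => resZ (α i j)) t μ hμ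

end Dual

end

end DualGerbe

/-!
# Gluing the stacks of tensor functors on `(Rep G, ⊗_Z)`

Every object of `A_Z = (Rep G, ⊗_Z)` is a direct summand of a finite sum of copies of the unit
object (`repZUnitGenerated`), and the endomorphism ring of the unit object is `k ^ Ĝ`
(`scalarEquiv`). Let `A` be any additive monoidal category generated by its unit object in this
sense. An additive functor `F` on `A`, together with an identification of its value at the unit
object with the unit object of the target `M`, is determined up to unique isomorphism by the ring
homomorphism `End (𝟙_ A) → End (𝟙_ M)` that it induces (`exists_natIso`, `natTrans_ext`). If `M` has
finite biproducts and split idempotents, then every such homomorphism occurs (`exists_functor`). The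
identification of the units extends to a tensor structure (`exists_braided`), and natural
transformations are monoidal as soon as they respect the units (`isMonoidal_of_unit`). Moreover, the
homomorphism depends on the isomorphism class of `F` only, whether or not the isomorphism respects
the units, because endomorphisms of a unit object commute (`unitMap_congr`). Finally `F` preserves
colimits, since linear forms separate the elements of any module over `k ^ Ĝ`
(`preservesColimits_of_hasEnoughForms`).

Consequently, the groupoid of tensor functors `A_Z ⥤ B_S` has no nontrivial automorphisms, and its
isomorphism classes are the `S`-valued points of `Spec (k ^ Ĝ)`, that is, the homomorphisms
`k ^ Ĝ → End (u_S)` (`tensClassification`). These form a sheaf since morphisms between objects of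
`B` do (`isSheaf_specPresheaf`), so that all the fibred categories in question are stacks
equivalent to sheaves of sets, and all the conditions on natural isomorphisms hold automatically.

What remains is to find the functor `κ'(α_ij)` on the level of points. It induces an automorphism
`σ_ij` of `k ^ Ĝ` (`sigma`). The natural isomorphisms `ρ(α_ik(β_ijk))` need not be monoidal for a
given choice of tensor structures, but their mere existence implies that `σ_ij ∘ σ_jk = σ_ik`
(`sigma_sigma`). This gives the unique monoidal natural isomorphisms (`existsUnique_tensorFamily`).
It also trivializes the descent datum: the indices run over all pairs, so after the choice of an
index `o` the relation `σ_oi ∘ σ_ij = σ_oj` says that `Spec (k ^ Ĝ)` itself, identified over `T_i`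
with the stack of tensor functors by means of `σ_oi`, is obtained by gluing (`gluing`).

Tensor structures for which the `ρ(α_ik(β_ijk))` are monoidal are also obtained from an index `o`:
the identifications `e_oj` of the units are arbitrary, and the others are imposed by the triples
`(o, i, j)`; the cocycle condition on `β` then takes care of all other triples
(`exists_isTensorFamily_muZ`).
-/

namespace DualGerbe

noncomputable section

/-! ### Points of objects of a monoidal category -/

section Points

variable {M : Type u₂} [Category.{v₂} M] [MonoidalCategory M]

/-- The point `x ⊙ y` of `X ⊗ Y` given by points `x` of `X` and `y` of `Y`, where a point of `X` is
a morphism from the unit object to `X`. -/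
def pmul {X Y : M} (x : 𝟙_ M ⟶ X) (y : 𝟙_ M ⟶ Y) : 𝟙_ M ⟶ X ⊗ Y :=
  (λ_ (𝟙_ M)).inv ≫ (x ⊗ₘ y)

lemma pmul_tensorHom {X Y X' Y' : M} (x : 𝟙_ M ⟶ X) (y : 𝟙_ M ⟶ Y) (f : X ⟶ X') (g : Y ⟶ Y') :
    pmul x y ≫ (f ⊗ₘ g) = pmul (x ≫ f) (y ≫ g) := by
  simp [pmul]

lemma pmul_whiskerRight {X Y X' : M} (x : 𝟙_ M ⟶ X) (y : 𝟙_ M ⟶ Y) (f : X ⟶ X') :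
    pmul x y ≫ f ▷ Y = pmul (x ≫ f) y := by
  rw [← tensorHom_id, pmul_tensorHom, Category.comp_id]

lemma pmul_whiskerLeft {X Y Y' : M} (x : 𝟙_ M ⟶ X) (y : 𝟙_ M ⟶ Y) (g : Y ⟶ Y') :
    pmul x y ≫ X ◁ g = pmul x (y ≫ g) := by
  rw [← id_tensorHom, pmul_tensorHom, Category.comp_id]

lemma pmul_leftUnitor {Y : M} (r : 𝟙_ M ⟶ 𝟙_ M) (y : 𝟙_ M ⟶ Y) :
    pmul r y ≫ (λ_ Y).hom = r ≫ y := by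
  simp [pmul, MonoidalCategory.tensorHom_def, ← MonoidalCategory.unitors_inv_equal,
    ← MonoidalCategory.unitors_equal]

lemma pmul_rightUnitor {X : M} (x : 𝟙_ M ⟶ X) (r : 𝟙_ M ⟶ 𝟙_ M) :
    pmul x r ≫ (ρ_ X).hom = r ≫ x := by
  simp [pmul, MonoidalCategory.tensorHom_def', ← MonoidalCategory.unitors_equal]

/-- Endomorphisms of the unit object commute. -/
lemma unit_end_comm (r s : 𝟙_ M ⟶ 𝟙_ M) : r ≫ s = s ≫ r := by
  rw [← pmul_leftUnitor, ← pmul_rightUnitor r s, MonoidalCategory.unitors_equal]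

lemma pmul_associator {X Y Z : M} (x : 𝟙_ M ⟶ X) (y : 𝟙_ M ⟶ Y) (z : 𝟙_ M ⟶ Z) :
    pmul (pmul x y) z ≫ (α_ X Y Z).hom = pmul x (pmul y z) := by
  have h : (λ_ (𝟙_ M)).inv ≫ (λ_ (𝟙_ M)).inv ▷ 𝟙_ M ≫ (α_ (𝟙_ M) (𝟙_ M) (𝟙_ M)).hom =
      (λ_ (𝟙_ M)).inv ≫ 𝟙_ M ◁ (λ_ (𝟙_ M)).inv := by
    monoidal
  have h1 : ((λ_ (𝟙_ M)).inv ≫ (x ⊗ₘ y)) ⊗ₘ z = (λ_ (𝟙_ M)).inv ▷ 𝟙_ M ≫ ((x ⊗ₘ y) ⊗ₘ z) := by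
    rw [← tensorHom_id, tensorHom_comp_tensorHom, Category.id_comp]
  have h2 : x ⊗ₘ ((λ_ (𝟙_ M)).inv ≫ (y ⊗ₘ z)) = 𝟙_ M ◁ (λ_ (𝟙_ M)).inv ≫ (x ⊗ₘ (y ⊗ₘ z)) := by
    rw [← id_tensorHom, tensorHom_comp_tensorHom, Category.id_comp]
  rw [pmul, pmul, pmul, pmul, h1, h2]
  simp only [Category.assoc, MonoidalCategory.associator_naturality]
  rw [reassoc_of% h]

lemma pmul_braiding [SymmetricCategory M] {X Y : M} (x : 𝟙_ M ⟶ X) (y : 𝟙_ M ⟶ Y) :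
    pmul x y ≫ (β_ X Y).hom = pmul y x := by
  simp [pmul, ← MonoidalCategory.unitors_equal]

lemma comp_pmul {X Y : M} (r s : 𝟙_ M ⟶ 𝟙_ M) (x : 𝟙_ M ⟶ X) (y : 𝟙_ M ⟶ Y) :
    pmul (r ≫ x) (s ≫ y) = r ≫ s ≫ pmul x y := by
  rw [← pmul_tensorHom]
  have : pmul r s = r ≫ s ≫ (λ_ (𝟙_ M)).inv := by
    rw [← Category.assoc, Iso.eq_comp_inv, pmul_leftUnitor]
  rw [this]
  simp [pmul]

end Points

/-! ### Objects generated by their points -/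

section Generation

variable {M : Type u₂} [Category.{v₂} M] [Preadditive M] [MonoidalCategory M]

/-- The points in `S` generate `X`: the identity of `X` is a finite sum of morphisms factoring
through points in `S`. -/
def Generates {X : M} (S : Set (𝟙_ M ⟶ X)) : Prop :=
  ∃ (n : ℕ) (p : Fin n → (X ⟶ 𝟙_ M)) (q : Fin n → (𝟙_ M ⟶ X)),
    (∀ i, q i ∈ S) ∧ ∑ i, p i ≫ q i = 𝟙 X

lemma Generates.of_fintype {I : Type w} [Fintype I] {X : M} {S : Set (𝟙_ M ⟶ X)}
    (p : I → (X ⟶ 𝟙_ M)) (q : I → (𝟙_ M ⟶ X)) (hq : ∀ i, q i ∈ S)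
    (h : ∑ i, p i ≫ q i = 𝟙 X) : Generates S := by
  refine ⟨Fintype.card I, p ∘ (Fintype.equivFin I).symm, q ∘ (Fintype.equivFin I).symm,
    fun i => hq _, ?_⟩
  rw [← h]
  exact (Fintype.equivFin I).symm.sum_comp fun i => p i ≫ q i

lemma Generates.hom_ext {X Y : M} {S : Set (𝟙_ M ⟶ X)} (hS : Generates S) {f g : X ⟶ Y}
    (h : ∀ x ∈ S, x ≫ f = x ≫ g) : f = g := by
  obtain ⟨n, p, q, hq, hs⟩ := hS
  rw [← Category.id_comp f, ← Category.id_comp g, ← hs, Preadditive.sum_comp, Preadditive.sum_comp]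
  exact Finset.sum_congr rfl fun i _ => by rw [Category.assoc, Category.assoc, h _ (hq i)]

lemma Generates.tensor [MonoidalPreadditive M] {X Y : M} {S : Set (𝟙_ M ⟶ X)}
    {S' : Set (𝟙_ M ⟶ Y)} (hS : Generates S) (hS' : Generates S') :
    Generates (Set.image2 pmul S S') := by
  obtain ⟨n, p, q, hq, hs⟩ := hS
  obtain ⟨n', p', q', hq', hs'⟩ := hS'
  refine Generates.of_fintype (I := Fin n × Fin n')
    (fun i => (p i.1 ⊗ₘ p' i.2) ≫ (λ_ (𝟙_ M)).hom) (fun i => pmul (q i.1) (q' i.2))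
    (fun i => ⟨_, hq _, _, hq' _, rfl⟩) ?_
  have e (i : Fin n × Fin n') : ((p i.1 ⊗ₘ p' i.2) ≫ (λ_ (𝟙_ M)).hom) ≫ pmul (q i.1) (q' i.2) =
      (p i.1 ≫ q i.1) ⊗ₘ (p' i.2 ≫ q' i.2) := by
    simp [pmul]
  simp only [e]
  rw [Fintype.sum_prod_type]
  simp only [← tensor_sum, ← sum_tensor, hs, hs']
  simp

/-- Every object is generated by its points, that is, it is a direct summand of a finite sum of
copies of the unit object. -/
class UnitGenerated (A : Type u₃) [Category.{v₃} A] [Preadditive A] [MonoidalCategory A] : Prop where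
  generates (a : A) : Generates (Set.univ : Set (𝟙_ A ⟶ a))

end Generation

/-! ### Functors on unit-generated categories -/

section Extension

variable {A : Type u₃} [Category.{v₃} A] [MonoidalCategory A]
  {M : Type u₂} [Category.{v₂} M] [MonoidalCategory M] {F F' : A ⥤ M}

/-- The image under `F` of a point, where the unit objects are identified along `e`. -/
def pt (e : 𝟙_ M ≅ F.obj (𝟙_ A)) {a : A} (x : 𝟙_ A ⟶ a) : 𝟙_ M ⟶ F.obj a :=
  e.hom ≫ F.map x

/-- The map `F : End (𝟙_ A) → End (𝟙_ M)`, where the unit objects are identified along `e`. -/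
def unitMap (e : 𝟙_ M ≅ F.obj (𝟙_ A)) (r : 𝟙_ A ⟶ 𝟙_ A) : 𝟙_ M ⟶ 𝟙_ M :=
  e.hom ≫ F.map r ≫ e.inv

variable (e : 𝟙_ M ≅ F.obj (𝟙_ A)) (e' : 𝟙_ M ≅ F'.obj (𝟙_ A))

lemma pt_map {a b : A} (x : 𝟙_ A ⟶ a) (f : a ⟶ b) : pt e x ≫ F.map f = pt e (x ≫ f) := by
  simp [pt]

lemma pt_id : pt e (𝟙 _) = e.hom := by
  simp [pt]

lemma pt_comp {a : A} (r : 𝟙_ A ⟶ 𝟙_ A) (x : 𝟙_ A ⟶ a) : pt e (r ≫ x) = unitMap e r ≫ pt e x := by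
  simp [pt, unitMap]

lemma pt_comp_inv (r : 𝟙_ A ⟶ 𝟙_ A) : pt e r ≫ e.inv = unitMap e r := by
  simp [pt, unitMap]

lemma unitMap_comp (r s : 𝟙_ A ⟶ 𝟙_ A) : unitMap e (r ≫ s) = unitMap e r ≫ unitMap e s := by
  simp [unitMap]

/-- As endomorphisms of the unit object commute, the map `F : End (𝟙_ A) → End (𝟙_ M)` depends on
the isomorphism class of `F` only. -/
lemma unitMap_congr (τ : F ≅ F') (r : 𝟙_ A ⟶ 𝟙_ A) : unitMap e r = unitMap e' r := by
  have h := unit_end_comm (e.hom ≫ τ.hom.app _ ≫ e'.inv) (unitMap e' r)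
  have h1 : (e.hom ≫ τ.hom.app _ ≫ e'.inv) ≫ unitMap e' r =
      unitMap e r ≫ (e.hom ≫ τ.hom.app _ ≫ e'.inv) := by
    simp [unitMap]
  rw [h1] at h
  have : IsIso (e.hom ≫ τ.hom.app _ ≫ e'.inv) := inferInstance
  rw [← cancel_mono (e.hom ≫ τ.hom.app _ ≫ e'.inv), h]

lemma pmul_pt_μ [F.LaxMonoidal] (he : Functor.LaxMonoidal.ε F = e.hom) {a b : A} (x : 𝟙_ A ⟶ a)
    (y : 𝟙_ A ⟶ b) : pmul (pt e x) (pt e y) ≫ Functor.LaxMonoidal.μ F a b = pt e (pmul x y) := by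
  have h := Functor.LaxMonoidal.left_unitality_inv F (𝟙_ A)
  have h1 : pmul (pt e x) (pt e y) =
      e.hom ≫ (λ_ (F.obj (𝟙_ A))).inv ≫ e.hom ▷ _ ≫ (F.map x ⊗ₘ F.map y) := by
    rw [pmul, pt, pt, ← tensorHom_comp_tensorHom, MonoidalCategory.tensorHom_def']
    simp
  rw [h1, ← he]
  simp only [Category.assoc, Functor.LaxMonoidal.μ_natural]
  rw [reassoc_of% h]
  simp [pt, pmul, he]

variable [Preadditive A] [Preadditive M] [F.Additive]

lemma unitMap_add (r s : 𝟙_ A ⟶ 𝟙_ A) : unitMap e (r + s) = unitMap e r + unitMap e s := by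
  simp [unitMap]

lemma generates_map {a : A} {S : Set (𝟙_ A ⟶ a)} (hS : Generates S) : Generates (pt e '' S) := by
  obtain ⟨n, p, q, hq, hs⟩ := hS
  refine ⟨n, fun i => F.map (p i) ≫ e.inv, fun i => pt e (q i), fun i => ⟨_, hq i, rfl⟩, ?_⟩
  simp [pt, ← Functor.map_comp, ← Functor.map_sum, hs]

variable [UnitGenerated A]

lemma pt_hom_ext {a : A} {m : M} {f g : F.obj a ⟶ m}
    (h : ∀ x : 𝟙_ A ⟶ a, pt e x ≫ f = pt e x ≫ g) : f = g := by
  refine (generates_map e (UnitGenerated.generates a)).hom_ext ?_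
  rintro _ ⟨x, -, rfl⟩
  exact h x

omit [F.Additive] in
/-- Morphisms `F a ⟶ m` correspond to `End (𝟙_ A)`-linear maps from the points of `a` to the
points of `m`. -/
lemma exists_hom_of_linear {a : A} {m : M} (g : (𝟙_ A ⟶ a) → (𝟙_ M ⟶ m))
    (hg : ∀ x y, g (x + y) = g x + g y) (hg' : ∀ r x, g (r ≫ x) = unitMap e r ≫ g x) :
    ∃ f : F.obj a ⟶ m, ∀ x, pt e x ≫ f = g x := by
  obtain ⟨n, p, q, -, hs⟩ := UnitGenerated.generates a
  -- `x = ∑ i, (x ≫ p i) ≫ q i`, with coefficients in `End (𝟙_ A)`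
  refine ⟨∑ i, F.map (p i) ≫ e.inv ≫ g (q i), fun x => ?_⟩
  have h1 (i) : pt e x ≫ F.map (p i) ≫ e.inv ≫ g (q i) = g (x ≫ p i ≫ q i) := by
    rw [reassoc_of% @pt_map, ← Category.assoc, pt_comp_inv, ← hg', Category.assoc]
  let G : (𝟙_ A ⟶ a) →+ (𝟙_ M ⟶ m) := AddMonoidHom.mk' g hg
  have h2 := map_sum G (fun i => x ≫ p i ≫ q i) Finset.univ
  rw [← Preadditive.comp_sum, hs, Category.comp_id] at h2
  rw [Preadditive.comp_sum]
  exact (Finset.sum_congr rfl fun i _ => h1 i).trans h2.symm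

/-- Functors inducing the same map on endomorphisms of the unit object are isomorphic. -/
lemma exists_natIso [F'.Additive] (h : ∀ r, unitMap e r = unitMap e' r) :
    ∃ τ : F ≅ F', e.hom ≫ τ.hom.app _ = e'.hom := by
  have h1 (a : A) := exists_hom_of_linear (F := F) (a := a) e (pt e')
    (fun x y => by simp [pt]) (fun r x => by rw [pt_comp, h])
  have h2 (a : A) := exists_hom_of_linear (F := F') (a := a) e' (pt e)
    (fun x y => by simp [pt]) (fun r x => by rw [pt_comp, h])
  choose f hf using h1
  choose g hg using h2
  refine ⟨NatIso.ofComponents (fun a => ⟨f a, g a, ?_, ?_⟩) ?_, ?_⟩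
  · exact pt_hom_ext e fun x => by rw [reassoc_of% hf, hg, Category.comp_id]
  · exact pt_hom_ext e' fun x => by rw [reassoc_of% hg, hf, Category.comp_id]
  · exact fun u => pt_hom_ext e fun x => by rw [reassoc_of% @pt_map, hf, reassoc_of% hf, pt_map]
  · simpa [pt_id] using hf _ (𝟙 _)

lemma natTrans_ext (τ τ' : F ⟶ F') (h : e.hom ≫ τ.app _ = e.hom ≫ τ'.app _) : τ = τ' := by
  ext a
  refine pt_hom_ext e fun x => ?_
  simp only [pt, Category.assoc, NatTrans.naturality]
  rw [reassoc_of% h]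

variable [MonoidalPreadditive M]

/-- A natural transformation between additive monoidal functors is monoidal as soon as it is
compatible with the units. -/
lemma isMonoidal_of_unit [F.Monoidal] [F'.Monoidal] (τ : F ⟶ F')
    (h : Functor.LaxMonoidal.ε F ≫ τ.app _ = Functor.LaxMonoidal.ε F') :
    NatTrans.IsMonoidal τ where
  unit := h
  tensor a b := by
    have key {a : A} (x : 𝟙_ A ⟶ a) :
        pt (Functor.Monoidal.εIso F) x ≫ τ.app a = pt (Functor.Monoidal.εIso F') x := by
      simp [pt, reassoc_of% h]
    refine ((generates_map (Functor.Monoidal.εIso F) (UnitGenerated.generates a)).tensor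
      (generates_map (Functor.Monoidal.εIso F) (UnitGenerated.generates b))).hom_ext ?_
    rintro _ ⟨_, ⟨x, -, rfl⟩, _, ⟨y, -, rfl⟩, rfl⟩
    rw [← Category.assoc, pmul_pt_μ _ rfl, key, reassoc_of% @pmul_tensorHom, key, key,
      pmul_pt_μ _ rfl]

variable [MonoidalPreadditive A]

/-- The tensor structure of an additive functor `F` determined by an isomorphism `𝟙_ M ≅ F (𝟙_ A)`,
on points. -/
lemma exists_tensorIso (a b : A) : ∃ μ : F.obj a ⊗ F.obj b ≅ F.obj (a ⊗ b),
    ∀ x y, pmul (pt e x) (pt e y) ≫ μ.hom = pt e (pmul x y) := by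
  have ga := UnitGenerated.generates a
  have gb := UnitGenerated.generates b
  have gF := (generates_map e ga).tensor (generates_map e gb)
  have gF' := generates_map e (ga.tensor gb)
  obtain ⟨n, p, q, -, hs⟩ := ga
  obtain ⟨n', p', q', -, hs'⟩ := gb
  -- expand both arguments in the generators, on which the isomorphism is prescribed
  let f : F.obj a ⊗ F.obj b ⟶ F.obj (a ⊗ b) := ∑ i, ∑ j,
    ((F.map (p i) ≫ e.inv) ⊗ₘ (F.map (p' j) ≫ e.inv)) ≫ (λ_ (𝟙_ M)).hom ≫ pt e (pmul (q i) (q' j))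
  let g : F.obj (a ⊗ b) ⟶ F.obj a ⊗ F.obj b := ∑ i, ∑ j,
    F.map ((p i ⊗ₘ p' j) ≫ (λ_ (𝟙_ A)).hom) ≫ e.inv ≫ pmul (pt e (q i)) (pt e (q' j))
  have hf (x : 𝟙_ A ⟶ a) (y : 𝟙_ A ⟶ b) : pmul (pt e x) (pt e y) ≫ f = pt e (pmul x y) := by
    have h1 (i j) : pmul (pt e x) (pt e y) ≫
        ((F.map (p i) ≫ e.inv) ⊗ₘ (F.map (p' j) ≫ e.inv)) ≫ (λ_ (𝟙_ M)).hom ≫ pt e (pmul (q i) (q' j)) =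
          pt e (pmul x y ≫ ((p i ≫ q i) ⊗ₘ (p' j ≫ q' j))) := by
      rw [reassoc_of% @pmul_tensorHom, reassoc_of% @pmul_leftUnitor,
        reassoc_of% @pt_map, reassoc_of% @pt_map, pt_comp_inv,
        pt_comp_inv, ← pt_comp, ← pt_comp, ← comp_pmul, pmul_tensorHom,
        Category.assoc, Category.assoc]
    simp only [f, Preadditive.comp_sum, h1]
    simp only [pt, ← Preadditive.comp_sum, ← Functor.map_sum, ← tensor_sum, ← sum_tensor, hs, hs']
    simp
  have hg (x : 𝟙_ A ⟶ a) (y : 𝟙_ A ⟶ b) : pt e (pmul x y) ≫ g = pmul (pt e x) (pt e y) := by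
    have h1 (i j) : pt e (pmul x y) ≫
        F.map ((p i ⊗ₘ p' j) ≫ (λ_ (𝟙_ A)).hom) ≫ e.inv ≫ pmul (pt e (q i)) (pt e (q' j)) =
          pmul (pt e x) (pt e y) ≫ (F.map (p i ≫ q i) ⊗ₘ F.map (p' j ≫ q' j)) := by
      rw [reassoc_of% @pt_map, reassoc_of% @pmul_tensorHom, pmul_leftUnitor, ← Category.assoc, pt_comp_inv,
        unitMap_comp, Category.assoc, ← comp_pmul, ← pt_comp, ← pt_comp,
        pmul_tensorHom, pt_map, pt_map, Category.assoc, Category.assoc]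
    simp only [g, Preadditive.comp_sum, h1]
    simp only [← Preadditive.comp_sum, ← tensor_sum, ← sum_tensor, ← Functor.map_sum, hs, hs']
    simp
  refine ⟨⟨f, g, gF.hom_ext ?_, gF'.hom_ext ?_⟩, hf⟩
  · rintro _ ⟨_, ⟨x, -, rfl⟩, _, ⟨y, -, rfl⟩, rfl⟩
    rw [reassoc_of% hf, hg, Category.comp_id]
  · rintro _ ⟨_, ⟨x, -, y, -, rfl⟩, rfl⟩
    rw [reassoc_of% hg, hf, Category.comp_id]

/-- An additive functor `F` and an isomorphism `𝟙_ M ≅ F (𝟙_ A)` determine a tensor structure on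
`F`. -/
lemma exists_braided [SymmetricCategory A] [SymmetricCategory M] :
    ∃ _ : F.Braided, Functor.LaxMonoidal.ε F = e.hom := by
  choose μ hμ using exists_tensorIso (F := F) e
  have g (a : A) := generates_map e (UnitGenerated.generates a)
  have g₂ (a b : A) := (g a).tensor (g b)
  let c : F.CoreMonoidal :=
    { εIso := e
      μIso := μ
      μIso_hom_natural_left := fun f b => (g₂ _ _).hom_ext (by
        rintro _ ⟨_, ⟨x, -, rfl⟩, _, ⟨y, -, rfl⟩, rfl⟩
        rw [reassoc_of% @pmul_whiskerRight, pt_map, hμ, reassoc_of% hμ, pt_map, pmul_whiskerRight])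
      μIso_hom_natural_right := fun b f => (g₂ _ _).hom_ext (by
        rintro _ ⟨_, ⟨x, -, rfl⟩, _, ⟨y, -, rfl⟩, rfl⟩
        rw [reassoc_of% @pmul_whiskerLeft, pt_map, hμ, reassoc_of% hμ, pt_map, pmul_whiskerLeft])
      associativity := fun X Y Z => ((g₂ X Y).tensor (g Z)).hom_ext (by
        rintro _ ⟨_, ⟨_, ⟨x, -, rfl⟩, _, ⟨y, -, rfl⟩, rfl⟩, _, ⟨z, -, rfl⟩, rfl⟩
        rw [reassoc_of% @pmul_whiskerRight, hμ, reassoc_of% hμ, pt_map, pmul_associator,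
          reassoc_of% @pmul_associator, reassoc_of% @pmul_whiskerLeft, hμ, hμ])
      left_unitality := fun X => by
        refine ((Generates.of_fintype (I := Unit) (S := {𝟙 (𝟙_ M)}) (fun _ => 𝟙 _)
          (fun _ => 𝟙 _) (fun _ => rfl) (by simp)).tensor (g X)).hom_ext ?_
        rintro _ ⟨_, rfl, _, ⟨x, -, rfl⟩, rfl⟩
        rw [pmul_leftUnitor, reassoc_of% @pmul_whiskerRight, Category.id_comp,
          Category.id_comp, ← pt_id e,
          reassoc_of% hμ, pt_map, pmul_leftUnitor, Category.id_comp]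
      right_unitality := fun X => by
        refine ((g X).tensor (Generates.of_fintype (I := Unit) (S := {𝟙 (𝟙_ M)}) (fun _ => 𝟙 _)
          (fun _ => 𝟙 _) (fun _ => rfl) (by simp))).hom_ext ?_
        rintro _ ⟨_, ⟨x, -, rfl⟩, _, rfl, rfl⟩
        rw [pmul_rightUnitor, reassoc_of% @pmul_whiskerLeft, Category.id_comp,
          Category.id_comp, ← pt_id e,
          reassoc_of% hμ, pt_map, pmul_rightUnitor, Category.id_comp] }
  let m : F.Monoidal := c.toMonoidal
  refine ⟨{ toMonoidal := m, braided := fun X Y => (g₂ _ _).hom_ext ?_ }, rfl⟩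
  rintro _ ⟨_, ⟨x, -, rfl⟩, _, ⟨y, -, rfl⟩, rfl⟩
  change _ ≫ (μ X Y).hom ≫ _ = _ ≫ _ ≫ (μ Y X).hom
  rw [reassoc_of% hμ, pt_map, pmul_braiding, reassoc_of% @pmul_braiding, hμ]

end Extension

/-! ### Functors with a given action on the endomorphisms of the unit object -/

section Extension

variable {A : Type u₃} [Category.{v₃} A] [Preadditive A] [MonoidalCategory A]
  {M : Type u₂} [Category.{v₂} M] [Preadditive M] [MonoidalCategory M]

/-- The ring homomorphism `F : End (𝟙_ A) → End (𝟙_ M)`, where the unit objects are identified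
along `e`. -/
def unitHom {F : A ⥤ M} [F.Additive] (e : 𝟙_ M ≅ F.obj (𝟙_ A)) : End (𝟙_ A) →+* End (𝟙_ M) where
  toFun r := unitMap e r
  map_one' := by simp [unitMap, End.one_def]
  map_mul' r s := unitMap_comp e s r
  map_zero' := (AddMonoidHom.mk' (unitMap e) (unitMap_add e)).map_zero
  map_add' r s := unitMap_add e r s

variable [UnitGenerated A]

lemma map_smul_of_unitMap {Λ : Type w} [CommRing Λ] {k : Type w'} [CommRing k] [Algebra Λ k]
    [Linear k A] [Linear Λ M] {F : A ⥤ M} [F.Additive] (e : 𝟙_ M ≅ F.obj (𝟙_ A))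
    (h : ∀ r : Λ, unitMap e (algebraMap Λ k r • 𝟙 (𝟙_ A)) = r • 𝟙 (𝟙_ M)) (r : Λ) {a b : A}
    (f : a ⟶ b) : F.map (algebraMap Λ k r • f) = r • F.map f := by
  refine pt_hom_ext e fun x => ?_
  rw [pt_map, Linear.comp_smul, Linear.comp_smul, pt_map]
  have : algebraMap Λ k r • x ≫ f = (algebraMap Λ k r • 𝟙 (𝟙_ A)) ≫ x ≫ f := by
    rw [Linear.smul_comp, Category.id_comp]
  rw [this, pt_comp, h, Linear.smul_comp, Category.id_comp]

/-- Every ring homomorphism `End (𝟙_ A) → End (𝟙_ M)` is induced by an additive functor. It sends an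
object cut out of a sum of copies of `𝟙_ A` by an idempotent matrix over `End (𝟙_ A)` to the object
cut out by the image of that matrix. -/
lemma exists_functor [HasFiniteBiproducts M] [IsIdempotentComplete M]
    (φ : End (𝟙_ A) →+* End (𝟙_ M)) :
    ∃ (F : A ⥤ M) (_ : F.Additive) (e : 𝟙_ M ≅ F.obj (𝟙_ A)), unitHom e = φ := by
  let φ' : (𝟙_ A ⟶ 𝟙_ A) →+ (𝟙_ M ⟶ 𝟙_ M) := φ.toAddMonoidHom
  have hc (r s : 𝟙_ A ⟶ 𝟙_ A) : φ' r ≫ φ' s = φ' (r ≫ s) := (φ.map_mul s r).symm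
  have hone : φ' (𝟙 _) = 𝟙 _ := φ.map_one
  choose n p q _ hs using fun a : A => UnitGenerated.generates a
  have hsum {a b : A} (x : 𝟙_ A ⟶ a) (y : a ⟶ b) : ∑ i, (x ≫ p a i) ≫ q a i ≫ y = x ≫ y := by
    have : x ≫ (∑ i, p a i ≫ q a i) ≫ y = x ≫ y := by rw [hs, Category.id_comp]
    simpa [Preadditive.comp_sum, Preadditive.sum_comp] using this
  -- `X` is cut out of `n a` copies of `𝟙_ M` by the image of the idempotent matrix of `a`
  have key (a : A) : ∃ (X : M) (P : Fin (n a) → (X ⟶ 𝟙_ M)) (Q : Fin (n a) → (𝟙_ M ⟶ X)),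
      (∀ i j, Q i ≫ P j = φ' (q a i ≫ p a j)) ∧ ∑ i, P i ≫ Q i = 𝟙 X := by
    let B : M := ⨁ fun _ : Fin (n a) => 𝟙_ M
    let E : B ⟶ B := biproduct.matrix fun i j => φ' (q a i ≫ p a j)
    have hE : E ≫ E = E := by
      refine biproduct.hom_ext' _ _ fun i => biproduct.hom_ext _ _ fun j => ?_
      simp only [E, Category.assoc, biproduct.matrix_π, biproduct.ι_matrix_assoc,
        biproduct.lift_desc, biproduct.ι_desc, hc]
      rw [← map_sum]
      congr 1
      simpa using hsum (q a i) (p a j)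
    obtain ⟨X, ι, π, h1, h2⟩ := IsIdempotentComplete.idempotents_split B E hE
    refine ⟨X, fun i => ι ≫ biproduct.π _ i, fun i => biproduct.ι (fun _ => 𝟙_ M) i ≫ π,
      fun i j => ?_, ?_⟩
    · rw [Category.assoc, reassoc_of% h2]
      simp [E]
    · have : ι ≫ (∑ i, biproduct.π (fun _ : Fin (n a) => 𝟙_ M) i ≫
          biproduct.ι (fun _ : Fin (n a) => 𝟙_ M) i) ≫ π = 𝟙 X := by
        rw [biproduct.total, Category.id_comp, h1]
      simpa [Preadditive.comp_sum, Preadditive.sum_comp] using this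
  choose X P Q hQP hPQ using key
  let mp {a b : A} (f : a ⟶ b) : X a ⟶ X b :=
    ∑ i, ∑ j, P a i ≫ φ' (q a i ≫ f ≫ p b j) ≫ Q b j
  have Q_mp {a b : A} (x : 𝟙_ A ⟶ a) (f : a ⟶ b) :
      (∑ i, φ' (x ≫ p a i) ≫ Q a i) ≫ mp f = ∑ j, φ' (x ≫ f ≫ p b j) ≫ Q b j := by
    have hQ (i) : Q a i ≫ mp f = ∑ j, φ' (q a i ≫ f ≫ p b j) ≫ Q b j := by
      simp only [mp, Preadditive.comp_sum, reassoc_of% hQP, reassoc_of% hc]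
      rw [Finset.sum_comm]
      refine Finset.sum_congr rfl fun j _ => ?_
      rw [← Preadditive.sum_comp, ← map_sum, hsum]
    rw [Preadditive.sum_comp]
    simp only [Category.assoc, hQ, Preadditive.comp_sum, reassoc_of% hc]
    rw [Finset.sum_comm]
    refine Finset.sum_congr rfl fun j _ => ?_
    rw [← Preadditive.sum_comp, ← map_sum]
    congr 2
    simpa using hsum x (f ≫ p b j)
  have Q_self {a : A} (i : Fin (n a)) : ∑ j, φ' (q a i ≫ p a j) ≫ Q a j = Q a i := by
    simp only [← hQP, Category.assoc]
    rw [← Preadditive.comp_sum, hPQ, Category.comp_id]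
  have Q_ext {a : A} {m : M} {f g : X a ⟶ m} (h : ∀ i, Q a i ≫ f = Q a i ≫ g) : f = g := by
    rw [← Category.id_comp f, ← Category.id_comp g, ← hPQ]
    simp [Preadditive.sum_comp, h]
  let F : A ⥤ M :=
    { obj := X
      map := mp
      map_id := fun a => Q_ext fun i => by
        rw [← Q_self, Q_mp]
        simp
      map_comp := fun f g => Q_ext fun i => by
        rw [← Q_self, Q_mp, ← Category.assoc, Q_mp]
        have := Q_mp (q _ i ≫ f) g
        simp only [Category.assoc] at this ⊢
        rw [this] }
  have hF : F.Additive :=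
    { map_add := fun {a b f g} => by
        change mp (f + g) = mp f + mp g
        simp only [mp, Preadditive.add_comp, Preadditive.comp_add, map_add,
          ← Finset.sum_add_distrib] }
  have hinv : (∑ j, φ' (p (𝟙_ A) j) ≫ Q _ j) ≫ (∑ i, P _ i ≫ φ' (q (𝟙_ A) i)) = 𝟙 _ := by
    simp only [Preadditive.comp_sum, Preadditive.sum_comp, Category.assoc, reassoc_of% hQP, hc]
    simp only [← map_sum]
    rw [← hone]
    congr 1
    have := congrArg₂ (· ≫ ·) (hs (𝟙_ A)) (hs (𝟙_ A))
    simpa [Preadditive.comp_sum, Preadditive.sum_comp] using this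
  let e : 𝟙_ M ≅ F.obj (𝟙_ A) :=
    { hom := ∑ j, φ' (p (𝟙_ A) j) ≫ Q _ j
      inv := ∑ i, P _ i ≫ φ' (q (𝟙_ A) i)
      hom_inv_id := hinv
      inv_hom_id := by
        change _ = 𝟙 (X _)
        refine Q_ext fun i => ?_
        have h1 : Q (𝟙_ A) i ≫ (∑ i, P _ i ≫ φ' (q (𝟙_ A) i)) = φ' (q _ i) := by
          simp only [Preadditive.comp_sum, reassoc_of% hQP, hc, ← map_sum]
          congr 1
          simpa using hsum (q _ i) (𝟙 _)
        rw [reassoc_of% h1, Preadditive.comp_sum]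
        simp only [reassoc_of% hc, Q_self, Category.comp_id] }
  refine ⟨F, hF, e, RingHom.ext fun r => ?_⟩
  change e.hom ≫ mp r ≫ e.inv = φ' r
  have h1 := Q_mp (𝟙 _) r
  simp only [Category.id_comp] at h1
  change (∑ j, φ' (p (𝟙_ A) j) ≫ Q _ j) ≫ mp r ≫ _ = _
  rw [reassoc_of% h1]
  have h2 : ∑ j, φ' (r ≫ p (𝟙_ A) j) ≫ Q (𝟙_ A) j = φ' r ≫ e.hom := by
    simp only [e, Preadditive.comp_sum, reassoc_of% hc]
  rw [h2, Category.assoc, e.hom_inv_id, Category.comp_id]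

end Extension

/-! ### Preservation of colimits -/

section Colimits

/-- Every nonzero element of an `R`-module is detected by a linear form with values in `R`. -/
def HasEnoughForms (R : Type w) [CommRing R] : Prop :=
  ∀ (N : Type w') [AddCommGroup N] [Module R N] (x : N), x ≠ 0 → ∃ l : N →ₗ[R] R, l x ≠ 0

lemma hasEnoughForms_pi (k : Type w) [Field k] (I : Type w'') [Finite I] :
    HasEnoughForms.{max w w'', w'} (I → k) := by
  classical
  have := Fintype.ofFinite I
  intro N _ _ x hx
  obtain ⟨i, hi⟩ : ∃ i, (Pi.single i 1 : I → k) • x ≠ 0 := by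
    by_contra hcon
    push Not at hcon
    apply hx
    have h1 : (1 : I → k) = ∑ i, Pi.single i 1 := (Finset.univ_sum_single (1 : I → k)).symm
    rw [← one_smul (I → k) x, h1, Finset.sum_smul]
    exact Finset.sum_eq_zero fun i _ => hcon i
  let := Module.compHom N (algebraMap k (I → k))
  have hsm (a : k) (y : N) : a • y = algebraMap k (I → k) a • y := rfl
  obtain ⟨f, hf⟩ : ∃ f : Module.Dual k N, f ((Pi.single i 1 : I → k) • x) ≠ 0 := by
    by_contra hcon
    push Not at hcon
    exact hi ((Module.forall_dual_apply_eq_zero_iff k _).1 hcon)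
  refine ⟨{ toFun := fun y => Pi.single i (f ((Pi.single i 1 : I → k) • y))
            map_add' := fun y z => by rw [smul_add, map_add, Pi.single_add]
            map_smul' := fun r y => ?_ }, fun h => hf (by simpa using h)⟩
  have h1 : (Pi.single i 1 : I → k) • r • y = r i • (Pi.single i 1 : I → k) • y := by
    rw [hsm, smul_smul, smul_smul]
    congr 1
    ext j
    by_cases hj : j = i
    · subst hj; simp
    · simp [hj]
  rw [h1, map_smul]
  ext j
  by_cases hj : j = i
  · subst hj; simp
  · simp [hj]

variable {M : Type u₂} [Category.{v₂} M] [Preadditive M] [MonoidalCategory M]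
  {R : Type w} [CommRing R]

/-- The module structure on the points of `m` given by a ring homomorphism `R → End (𝟙_ M)`. -/
abbrev pointModule (φ : R →+* End (𝟙_ M)) (m : M) : Module R (𝟙_ M ⟶ m) where
  smul r f := (φ r : 𝟙_ M ⟶ 𝟙_ M) ≫ f
  one_smul f := by
    change (φ 1 : 𝟙_ M ⟶ 𝟙_ M) ≫ f = f
    rw [map_one]
    exact Category.id_comp f
  mul_smul r s f := by
    change (φ (r * s) : 𝟙_ M ⟶ 𝟙_ M) ≫ f =
      (φ r : 𝟙_ M ⟶ 𝟙_ M) ≫ (φ s : 𝟙_ M ⟶ 𝟙_ M) ≫ f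
    rw [mul_comm, map_mul]
    exact Category.assoc _ _ _
  smul_zero r := comp_zero
  smul_add r f g := Preadditive.comp_add _ _ _ _ _ _
  add_smul r s f := by
    change (φ (r + s) : 𝟙_ M ⟶ 𝟙_ M) ≫ f = _
    rw [map_add]
    exact Preadditive.add_comp _ _ _ _ _ _
  zero_smul f := by
    change (φ 0 : 𝟙_ M ⟶ 𝟙_ M) ≫ f = 0
    rw [map_zero]
    exact zero_comp

variable {A : Type u₃} [Category.{v₃} A] [Preadditive A] [MonoidalCategory A] [UnitGenerated A]

/-- If `End (𝟙_ A)` has enough linear forms, then an additive functor on `A` preserves all the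
colimits that exist in `A`, as a colimit cocone of `A` is also one for compatible families of linear
maps to an arbitrary `End (𝟙_ A)`-module. -/
lemma preservesColimits_of_hasEnoughForms (θ : R ≃+* End (𝟙_ A))
    (h : HasEnoughForms.{w, v₃} R) (h' : HasEnoughForms.{w, v₂} R) (F : A ⥤ M) [F.Additive]
    (e : 𝟙_ M ≅ F.obj (𝟙_ A)) : PreservesColimitsOfSize.{w', w''} F := by
  refine ⟨fun {J} _ => ⟨fun {K} => ⟨fun {c} hc => ⟨IsColimit.ofExistsUnique fun s => ?_⟩⟩⟩⟩
  let mA (a : A) : Module R (𝟙_ A ⟶ a) := pointModule θ.toRingHom a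
  let φ : R →+* End (𝟙_ M) := (unitHom e).comp θ.toRingHom
  let mM (m : M) : Module R (𝟙_ M ⟶ m) := pointModule φ m
  have smA {a : A} (r : R) (x : 𝟙_ A ⟶ a) : r • x = (θ r : 𝟙_ A ⟶ 𝟙_ A) ≫ x := rfl
  have smM {m : M} (r : R) (x : 𝟙_ M ⟶ m) :
      r • x = unitMap e (θ r : 𝟙_ A ⟶ 𝟙_ A) ≫ x := rfl
  -- linear forms on the points of `a` are morphisms `a ⟶ 𝟙_ A`
  have form {a : A} (l : (𝟙_ A ⟶ a) →ₗ[R] R) :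
      ∃ t : a ⟶ 𝟙_ A, ∀ x, x ≫ t = (θ (l x) : 𝟙_ A ⟶ 𝟙_ A) := by
    obtain ⟨t, ht⟩ := exists_hom_of_linear (F := 𝟭 A) (Iso.refl _)
      (fun x => (θ (l x) : 𝟙_ A ⟶ 𝟙_ A))
      (fun x y => by rw [map_add, map_add]) (fun r x => by
        have h1 : r ≫ x = θ.symm r • x := by
          rw [smA]; exact congrArg (· ≫ x) (θ.apply_symm_apply r).symm
        have h2 : unitMap (F := 𝟭 A) (Iso.refl _) r = r := by simp [unitMap]
        rw [h1, map_smul, smul_eq_mul, mul_comm, map_mul, θ.apply_symm_apply, h2]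
        rfl)
    exact ⟨t, fun x => by simpa [pt] using ht x⟩
  let I := Σ j, (𝟙_ A ⟶ K.obj j)
  let π : (I →₀ R) →ₗ[R] (𝟙_ A ⟶ c.pt) := Finsupp.linearCombination R fun i => i.2 ≫ c.ι.app i.1
  let γ : (I →₀ R) →ₗ[R] (𝟙_ M ⟶ s.pt) :=
    Finsupp.linearCombination R fun i => pt e i.2 ≫ s.ι.app i.1
  -- the points of `c.pt` are spanned by those of the objects of the diagram
  have hπ : Function.Surjective π := by
    rw [← LinearMap.range_eq_top]
    by_contra hne
    obtain ⟨y, hy⟩ : ∃ y, y ∉ LinearMap.range π := by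
      by_contra hcon
      push Not at hcon
      exact hne (eq_top_iff.2 fun y _ => hcon y)
    obtain ⟨l, hl⟩ := h ((𝟙_ A ⟶ c.pt) ⧸ LinearMap.range π) (Submodule.Quotient.mk y)
      (by rwa [Ne, Submodule.Quotient.mk_eq_zero])
    obtain ⟨t, ht⟩ := form (l.comp (LinearMap.range π).mkQ)
    have ht0 : t = 0 := hc.hom_ext fun j => by
      refine (UnitGenerated.generates (K.obj j)).hom_ext fun x _ => ?_
      have h1 : (LinearMap.range π).mkQ (x ≫ c.ι.app j) = 0 := by
        rw [Submodule.mkQ_apply, Submodule.Quotient.mk_eq_zero]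
        exact ⟨Finsupp.single ⟨j, x⟩ 1, by simp [π]⟩
      rw [← Category.assoc, ht, LinearMap.comp_apply, h1, map_zero, map_zero, comp_zero, comp_zero]
    refine hl (θ.injective ?_)
    have h2 := ht y
    rw [ht0, comp_zero] at h2
    rw [map_zero]
    exact h2.symm
  -- a linear form that detects `γ d` turns `s` into a cocone in `A` with vertex `𝟙_ A`
  have hγ (d : I →₀ R) (hd : π d = 0) : γ d = 0 := by
    by_contra hne
    obtain ⟨l, hl⟩ := h' _ (γ d) hne
    let L (j : J) : (𝟙_ A ⟶ K.obj j) →ₗ[R] (𝟙_ M ⟶ s.pt) :=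
      { toFun := fun x => pt e x ≫ s.ι.app j
        map_add' := fun x y => by simp [pt]
        map_smul' := fun r x => by
          rw [smA, pt_comp, Category.assoc]
          rfl }
    have g (j : J) : ∃ t : K.obj j ⟶ 𝟙_ A, ∀ x, x ≫ t =
        (θ (l (pt e x ≫ s.ι.app j)) : 𝟙_ A ⟶ 𝟙_ A) := form (l.comp (L j))
    choose t ht using g
    let t' : Cocone K :=
      { pt := 𝟙_ A
        ι :=
          { app := t
            naturality := fun i j u => (UnitGenerated.generates (K.obj i)).hom_ext fun x _ => by
              have := s.w u
              simp only [Functor.comp_map] at this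
              rw [← Category.assoc, ht]
              simp [ht, ← pt_map, this] } }
    have h3 (d : I →₀ R) : π d ≫ hc.desc t' = (θ (l (γ d)) : 𝟙_ A ⟶ 𝟙_ A) := by
      induction d using Finsupp.induction_linear with
      | zero => simp only [map_zero, zero_comp]
      | add d d' hd hd' => rw [map_add, Preadditive.add_comp, hd, hd', map_add, map_add, map_add]
      | single i r =>
        simp only [π, γ, Finsupp.linearCombination_single, map_smul, smA, Category.assoc, hc.fac]
        rw [smul_eq_mul, mul_comm, map_mul]
        exact congrArg (_ ≫ ·) (ht i.1 i.2)
    have h4 := h3 d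
    rw [hd, zero_comp] at h4
    exact hl (θ.injective (h4.symm.trans (map_zero θ).symm))
  have hγ' {d d' : I →₀ R} (hd : π d = π d') : γ d = γ d' := by
    rw [← sub_eq_zero, ← map_sub]
    exact hγ _ (by rw [map_sub, hd, sub_self])
  obtain ⟨σ, hσ⟩ := hπ.hasRightInverse
  obtain ⟨f, hf⟩ := exists_hom_of_linear e (fun x : 𝟙_ A ⟶ c.pt => γ (σ x))
    (fun x y => by rw [← map_add]; exact hγ' (by rw [map_add, hσ, hσ, hσ]))
    (fun r x => by
      have h1 : r ≫ x = θ.symm r • x := by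
        rw [smA]; exact congrArg (· ≫ x) (θ.apply_symm_apply r).symm
      have h2 : unitMap e r ≫ γ (σ x) = γ (θ.symm r • σ x) := by
        rw [map_smul, smM]; exact congrArg (unitMap e · ≫ _) (θ.apply_symm_apply r).symm
      rw [h2]
      exact hγ' (by rw [map_smul, hσ, hσ, h1]))
  refine ⟨f, fun j => pt_hom_ext e fun x => ?_, fun f' hf' => pt_hom_ext e fun x => ?_⟩
  · change _ ≫ F.map (c.ι.app j) ≫ f = _
    rw [reassoc_of% @pt_map, hf]
    have h1 : γ (Finsupp.single ⟨j, x⟩ 1) = pt e x ≫ s.ι.app j := by simp [γ]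
    rw [← h1]
    exact hγ' (by rw [hσ]; simp [π])
  · obtain ⟨d, rfl⟩ := hπ x
    rw [hf, hγ' (hσ (π d))]
    induction d using Finsupp.induction_linear with
    | zero => simp [pt]
    | add d d' hd hd' =>
      rw [map_add, map_add, ← hd, ← hd']
      simp [pt]
    | single i r =>
      simp only [π, γ, Finsupp.linearCombination_single, smA, smM]
      rw [pt_comp, Category.assoc, ← pt_map, Category.assoc]
      exact congrArg (fun z => _ ≫ _ ≫ z) (hf' i.1)

end Colimits

/-! ### Families of objects of preadditive categories -/

section Families

variable {I : Type w} {D : I → Type u₁} [∀ i, Category.{v₁} (D i)] [∀ i, Preadditive (D i)]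

/-- Families of objects of preadditive categories form a preadditive category. -/
instance piPreadditive : Preadditive (∀ i, D i) where
  homGroup X Y := inferInstanceAs (AddCommGroup (∀ i, X i ⟶ Y i))
  add_comp _ _ _ _ _ _ := funext fun _ => Preadditive.add_comp _ _ _ _ _ _
  comp_add _ _ _ _ _ _ := funext fun _ => Preadditive.comp_add _ _ _ _ _ _

instance piMonoidalPreadditive [∀ i, MonoidalCategory (D i)] [∀ i, MonoidalPreadditive (D i)] :
    MonoidalPreadditive (∀ i, D i) where
  whiskerLeft_zero := funext fun _ => MonoidalPreadditive.whiskerLeft_zero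
  zero_whiskerRight := funext fun _ => MonoidalPreadditive.zero_whiskerRight
  whiskerLeft_add _ _ := funext fun _ => MonoidalPreadditive.whiskerLeft_add _ _
  add_whiskerRight _ _ := funext fun _ => MonoidalPreadditive.add_whiskerRight _ _

end Families

/-! ### The unit object of `(Rep G, ⊗_Z)` -/

section Rep

variable {k G : Type u} [Field k] [Group G] [IsAlgClosed k] [CharZero k] [Finite G]

instance chi_additive : (chi k G).Additive where
  map_add {_ _ f g} := funext fun _ => FGModuleCat.hom_ext (LinearMap.ext fun x =>
    Preadditive.comp_add _ _ _ x f g)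

instance repZHasFiniteBiproducts : HasFiniteBiproducts (RepZ k G) :=
  HasFiniteBiproducts.of_hasFiniteProducts (C := FDRep k G)

instance repZMonoidalPreadditive : MonoidalPreadditive (RepZ k G) := by
  let e := Monoidal.equivalenceTransported (chiEquiv k G)
  let : Preadditive (Monoidal.Transported (chiEquiv k G)) := repZPreadditive
  have : e.inverse.Additive := chi_additive
  exact monoidalPreadditive_of_faithful (D := Monoidal.Transported (chiEquiv k G)) e.inverse

variable (k G) in
/-- The unit object of `(Rep G, ⊗_Z)` as a representation. It corresponds under `χ` to the family
with all members equal to `k`. -/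
def unitZ : FDRep k G := (𝟙_ (RepZ k G) : RepZ k G)

lemma finrank_irr_unitZ (c : IrrChar k G) : Module.finrank k (irr c ⟶ unitZ k G) = 1 := by
  let e : (chi k G).obj (unitZ k G) ≅ fun _ => FGModuleCat.of k k :=
    (chiEquiv k G).unitIso.symm.app _
  let l := FGModuleCat.isoToLinearEquiv (Pi.isoApp e c)
  have : Module.finrank k (irr c ⟶ unitZ k G) = Module.finrank k k := l.finrank_eq
  rw [this, Module.finrank_self]

lemma exists_hom_of_form {V W : FDRep k G} (c : IrrChar k G) (l : (irr c ⟶ V) →ₗ[k] k)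
    (w : irr c ⟶ W) : ∃ f : V ⟶ W, (∀ y, y ≫ f = l y • w) ∧
      ∀ d, d ≠ c → ∀ y : irr d ⟶ V, y ≫ f = 0 := by
  classical
  obtain ⟨f, hf⟩ := ((good V) W).2 (Pi.single c (l.smulRight w))
  refine ⟨f, fun y => ?_, fun d hd y => ?_⟩
  · rw [← hf, Pi.single_eq_same]
    rfl
  · rw [← hf, Pi.single_eq_of_ne hd]
    rfl

lemma hom_ext_irr {V W : FDRep k G} {f g : V ⟶ W}
    (h : ∀ (c : IrrChar k G) (y : irr c ⟶ V), y ≫ f = y ≫ g) : f = g := ((good V) W).1 f g h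

variable (k G) in
lemma exists_generator (c : IrrChar k G) : ∃ x : irr c ⟶ unitZ k G, x ≠ 0 ∧
    ∀ y : irr c ⟶ unitZ k G, ∃ a : k, a • x = y :=
  finrank_eq_one_iff'.1 (finrank_irr_unitZ c)

/-- The unit object contains every irreducible representation with multiplicity one, so that any
representation is a direct summand of a sum of copies of it. -/
instance repZUnitGenerated : UnitGenerated (RepZ k G) where
  generates V := by
    classical
    have := Fintype.ofFinite (IrrChar k G)
    choose x hx0 hx using exists_generator k G
    have hform (c : IrrChar k G) : ∃ l : (irr c ⟶ unitZ k G) →ₗ[k] k, l (x c) = 1 := by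
      obtain ⟨l, hl⟩ := (Module.Projective.exists_dual_ne_zero k (hx0 c))
      exact ⟨(l (x c))⁻¹ • l, by simp [hl]⟩
    choose ξ hξ using hform
    let V' : FDRep k G := V
    let b (c : IrrChar k G) := Module.finBasis k (irr c ⟶ V')
    -- For each `c`, the `p i` and `q i` factor the projections to the members of a basis of
    -- `Hom (ρ_c, V)` through the copy of `ρ_c` in the unit object.
    have hp (i : Σ c : IrrChar k G, Fin (Module.finrank k (irr c ⟶ V'))) :=
      exists_hom_of_form i.1 ((b i.1).coord i.2) (x i.1)
    have hq (i : Σ c : IrrChar k G, Fin (Module.finrank k (irr c ⟶ V'))) :=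
      exists_hom_of_form i.1 (ξ i.1) (b i.1 i.2)
    choose p hp hp' using hp
    choose q hq _ using hq
    have h : ∑ i, p i ≫ q i = 𝟙 V' := hom_ext_irr fun c y => by
      rw [Preadditive.comp_sum, Category.comp_id, Fintype.sum_sigma, Finset.sum_eq_single c]
      · conv_rhs => rw [← (b c).sum_repr y]
        refine Finset.sum_congr rfl fun i _ => ?_
        rw [← Category.assoc, hp ⟨c, i⟩, Linear.smul_comp, hq ⟨c, i⟩, hξ, one_smul]
        rfl
      · intro d _ hd
        refine Finset.sum_eq_zero fun i _ => ?_
        rw [← Category.assoc, hp' ⟨d, i⟩ c hd.symm, zero_comp]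
      · simp
    exact Generates.of_fintype p q (fun _ => trivial) h

lemma exists_scalar (r : IrrChar k G → k) :
    ∃ f : unitZ k G ⟶ unitZ k G, ∀ (c : IrrChar k G) (y : irr c ⟶ unitZ k G), y ≫ f = r c • y := by
  obtain ⟨f, hf⟩ := ((good (unitZ k G)) (unitZ k G)).2 fun c => r c • LinearMap.id
  exact ⟨f, fun c y => (hf c y).symm⟩

/-- The endomorphism of the unit object by which `k ^ Ĝ` acts on it. -/
def scalarZ (r : IrrChar k G → k) : unitZ k G ⟶ unitZ k G := (exists_scalar r).choose

lemma comp_scalarZ (r : IrrChar k G → k) (c : IrrChar k G) (y : irr c ⟶ unitZ k G) :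
    y ≫ scalarZ r = r c • y := (exists_scalar r).choose_spec c y

lemma scalarZ_const (a : k) : scalarZ (fun _ => a) = a • 𝟙 (unitZ k G) :=
  hom_ext_irr fun c y => by rw [comp_scalarZ, Linear.comp_smul, Category.comp_id]

variable (k G) in
/-- The action of `k ^ Ĝ` on the unit object. -/
def scalarHom : (IrrChar k G → k) →+* End (𝟙_ (RepZ k G)) where
  toFun r := (scalarZ r : unitZ k G ⟶ unitZ k G)
  map_one' := (scalarZ_const 1).trans (one_smul _ _)
  map_mul' r s := hom_ext_irr fun c y => by
    change _ = y ≫ scalarZ s ≫ scalarZ r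
    rw [comp_scalarZ, ← Category.assoc, comp_scalarZ s, comp_scalarZ, smul_smul, Pi.mul_apply,
      mul_comm]
  map_zero' := (scalarZ_const 0).trans (zero_smul _ _)
  map_add' r s := hom_ext_irr fun c y => by
    change _ = y ≫ (scalarZ r + scalarZ s)
    rw [comp_scalarZ, Preadditive.comp_add, comp_scalarZ, comp_scalarZ, ← add_smul]
    rfl

variable (k G) in
/-- The isomorphism of `k ^ Ĝ` with the ring of endomorphisms of the unit object. -/
def scalarEquiv : (IrrChar k G → k) ≃+* End (𝟙_ (RepZ k G)) :=
  RingEquiv.ofBijective (scalarHom k G)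
    (by
      choose x hx0 hx using exists_generator k G
      constructor
      · intro r s h
        funext c
        have h1 : x c ≫ scalarZ r = x c ≫ scalarZ s := congrArg (x c ≫ ·) h
        rw [comp_scalarZ, comp_scalarZ] at h1
        exact smul_left_injective k (hx0 c) h1
      · intro (f : unitZ k G ⟶ unitZ k G)
        choose r hr using fun c => hx c (x c ≫ f)
        refine ⟨r, hom_ext_irr fun c y => ?_⟩
        obtain ⟨a, rfl⟩ := hx c y
        change _ ≫ scalarZ r = _ ≫ f
        rw [comp_scalarZ, Linear.smul_comp, ← hr, smul_comm])

lemma scalarEquiv_algebraMap (a : k) :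
    scalarEquiv k G (algebraMap k (IrrChar k G → k) a) = a • 𝟙 (𝟙_ (RepZ k G)) :=
  (scalarZ_const a : scalarZ (k := k) (G := G) (fun _ => a) = _)

lemma nonempty_iso_of_finrank {V W : FDRep k G}
    (h : ∀ c : IrrChar k G, Module.finrank k (irr c ⟶ V) = Module.finrank k (irr c ⟶ W)) :
    Nonempty (V ≅ W) :=
  ⟨(chi k G).preimageIso (Pi.isoMk fun c =>
    (LinearEquiv.ofFinrankEq (irr c ⟶ V) (irr c ⟶ W) (h c)).toFGModuleCatIso)⟩

/-- Composition with an automorphism of `G` permutes the irreducible representations, so it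
preserves the unit object of `⊗_Z`, in which each of them occurs once. -/
lemma nonempty_unit_iso_resZ (α : G ≃* G) :
    Nonempty (𝟙_ (RepZ k G) ≅ (resZ (k := k) α).obj (𝟙_ (RepZ k G))) := by
  let E : FDRep k G ⥤ FDRep k G := resZ α
  have hE : E.IsEquivalence := resZ_isEquivalence α
  have : E.Additive := ⟨rfl⟩
  have : E.Linear k := resZ_linear α
  refine nonempty_iso_of_finrank (V := unitZ k G) (W := E.obj (unitZ k G)) fun c => ?_
  let X := E.objPreimage (irr c)
  have hX : Simple X := by
    have := Simple.of_iso (E.objObjPreimageIso (irr c))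
    exact (simple_obj_iff E X).1 this
  let d : IrrChar k G := ⟨X.character, X, hX, rfl⟩
  obtain ⟨e⟩ := nonempty_iso_of_character_eq (irr_character d : _ = X.character)
  let e' : E.obj (irr d) ≅ irr c := E.mapIso e ≪≫ E.objObjPreimageIso (irr c)
  let l : (irr d ⟶ unitZ k G) ≃ₗ[k] (irr c ⟶ E.obj (unitZ k G)) :=
    (LinearEquiv.ofBijective (E.mapLinearMap k)
      ⟨E.map_injective, E.map_surjective⟩).trans (Linear.homCongr k e' (Iso.refl _))
  rw [← l.finrank_eq, finrank_irr_unitZ, finrank_irr_unitZ]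

end Rep

/-! ### Functoriality of the action on the endomorphisms of the unit object -/

section UnitMap

variable {A : Type u₃} [Category.{v₃} A] [MonoidalCategory A]
  {M : Type u₂} [Category.{v₂} M] [MonoidalCategory M] {N : Type u₄} [Category.{v₄} N]
  [MonoidalCategory N]

lemma unitMap_bijective {F : A ⥤ M} [F.Full] [F.Faithful] (e : 𝟙_ M ≅ F.obj (𝟙_ A)) :
    Function.Bijective (unitMap e) := by
  constructor
  · intro r s h
    apply F.map_injective
    simpa [unitMap] using h
  · intro r
    refine ⟨F.preimage (e.inv ≫ r ≫ e.hom), ?_⟩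
    simp [unitMap]

lemma unitMap_comp_functor {F : A ⥤ M} {H : M ⥤ N} (e : 𝟙_ M ≅ F.obj (𝟙_ A))
    (e' : 𝟙_ N ≅ H.obj (𝟙_ M)) (e'' : 𝟙_ N ≅ (F ⋙ H).obj (𝟙_ A)) (r : 𝟙_ A ⟶ 𝟙_ A) :
    unitMap e'' r = unitMap e' (unitMap e r) := by
  rw [unitMap_congr e'' (e' ≪≫ H.mapIso e : 𝟙_ N ≅ (F ⋙ H).obj (𝟙_ A)) (Iso.refl _) r]
  simp [unitMap]

end UnitMap

/-! ### The automorphisms `σ_α` of `k ^ Ĝ` -/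

section Sigma

variable (Λ : Type w) [CommRing Λ] {k G : Type u} [Field k] [IsAlgClosed k] [CharZero k]
  [Algebra Λ k] [Group G] [Finite G]

instance resZ_additive (α : G ≃* G) : (resZ (k := k) α).Additive where
  map_add := rfl

/-- An isomorphism between the unit object and its image under `κ'(α)`. -/
def unitIsoResZ (α : G ≃* G) : 𝟙_ (RepZ k G) ≅ (resZ (k := k) α).obj (𝟙_ (RepZ k G)) :=
  (nonempty_unit_iso_resZ α).some

/-- The automorphism of `k ^ Ĝ ≅ End (𝟙_ A_Z)` induced by `κ'(α)`. -/
def sigma (α : G ≃* G) : (IrrChar k G → k) ≃ₐ[Λ] (IrrChar k G → k) :=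
  AlgEquiv.ofBijective
    (AlgHom.mk ((scalarEquiv k G).symm.toRingHom.comp
      ((unitHom (unitIsoResZ α)).comp (scalarEquiv k G).toRingHom)) (fun r => by
        have h : algebraMap Λ (IrrChar k G → k) r =
          algebraMap k (IrrChar k G → k) (algebraMap Λ k r) := rfl
        change (scalarEquiv k G).symm (unitMap (unitIsoResZ α) (scalarEquiv k G _)) = _
        rw [RingEquiv.symm_apply_eq, h, scalarEquiv_algebraMap]
        simp [unitMap, (resZ (k := k) α).map_smul]))
    ((scalarEquiv k G).symm.bijective.comp
      ((unitMap_bijective (unitIsoResZ α)).comp (scalarEquiv k G).bijective))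

lemma scalarEquiv_sigma (α : G ≃* G) (e : 𝟙_ (RepZ k G) ≅ (resZ (k := k) α).obj (𝟙_ (RepZ k G)))
    (r : IrrChar k G → k) :
    scalarEquiv k G (sigma Λ α r) = unitMap e (scalarEquiv k G r) := by
  rw [unitMap_congr e (unitIsoResZ α) (Iso.refl _)]
  exact (scalarEquiv k G).apply_symm_apply _

/-- The isomorphism `μ` is not required to be monoidal: by `unitMap_congr`, any isomorphism of
functors will do. -/
lemma sigma_sigma {α₁ α₂ α₃ : G ≃* G} (μ : resZ α₂ ⋙ resZ α₁ ≅ resZ (k := k) α₃)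
    (r : IrrChar k G → k) : sigma Λ α₁ (sigma Λ α₂ r) = sigma Λ α₃ r := by
  apply (scalarEquiv k G).injective
  rw [scalarEquiv_sigma Λ α₁ (unitIsoResZ α₁), scalarEquiv_sigma Λ α₂ (unitIsoResZ α₂),
    scalarEquiv_sigma Λ α₃ (unitIsoResZ α₃),
    ← unitMap_comp_functor _ _ (unitIsoResZ α₁ ≪≫ (resZ α₁).mapIso (unitIsoResZ α₂))]
  exact unitMap_congr _ _ μ _

end Sigma

/-! ### Tensor functors and points of `Spec (k ^ Ĝ)` -/

section Classification

variable {Λ : Type w} [CommRing Λ] {k G : Type u} [Field k] [IsAlgClosed k] [CharZero k]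
  [Algebra Λ k] [Group G] [Finite G]
  {M : Type u₂} [Category.{v₂} M] [Preadditive M] [HasFiniteBiproducts M] [Linear Λ M]
  [MonoidalCategory M] [SymmetricCategory M]

instance tensFun_additive (F : TensFun Λ k (RepZ k G) M) : F.functor.Additive := by
  have : HasBinaryBiproducts (RepZ k G) := hasBinaryBiproducts_of_finite_biproducts _
  have := preservesBinaryBiproducts_of_preservesBinaryCoproducts F.functor
  exact Functor.additive_of_preservesBinaryBiproducts F.functor

/-- The unit isomorphism of a tensor functor. -/
abbrev TensFun.unitIso (F : TensFun Λ k (RepZ k G) M) :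
    𝟙_ M ≅ F.functor.obj (𝟙_ (RepZ k G)) :=
  Functor.Monoidal.εIso F.functor

/-- The `M`-valued point of `Spec (k ^ Ĝ)` given by a tensor functor `A_Z ⥤ M`: the induced
homomorphism `k ^ Ĝ ≅ End (𝟙_ A_Z) → End (𝟙_ M)`. -/
def toPoint (F : TensFun Λ k (RepZ k G) M) : (IrrChar k G → k) →ₐ[Λ] End (𝟙_ M) where
  __ := (unitHom F.unitIso).comp (scalarEquiv k G).toRingHom
  commutes' r := by
    change unitMap F.unitIso (scalarEquiv k G (algebraMap k _ (algebraMap Λ k r))) = _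
    rw [scalarEquiv_algebraMap, Algebra.algebraMap_eq_smul_one (A := End (𝟙_ M))]
    change F.unitIso.hom ≫ F.functor.map (algebraMap Λ k r • 𝟙 _) ≫ F.unitIso.inv =
      r • 𝟙 (𝟙_ M)
    rw [F.map_smul, CategoryTheory.Functor.map_id, Linear.smul_comp, Category.id_comp,
      Linear.comp_smul, Iso.hom_inv_id]

lemma toPoint_apply (F : TensFun Λ k (RepZ k G) M) (r : IrrChar k G → k) :
    toPoint F r = unitMap F.unitIso (scalarEquiv k G r) := rfl

lemma toPoint_eq_of_hom {F F' : TensFun Λ k (RepZ k G) M} (f : F ⟶ F') : toPoint F = toPoint F' :=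
  AlgHom.ext fun _ => unitMap_congr _ _ f.iso _

instance tensFun_subsingleton (F F' : TensFun Λ k (RepZ k G) M) : Subsingleton (F ⟶ F') where
  allEq f g := by
    refine TensFun.Hom.ext (Iso.ext (natTrans_ext F.unitIso _ _ ?_))
    exact (NatTrans.IsMonoidal.unit (τ := f.iso.hom)).trans
      (NatTrans.IsMonoidal.unit (τ := g.iso.hom)).symm

variable [MonoidalPreadditive M]

lemma nonempty_hom_of_toPoint_eq {F F' : TensFun Λ k (RepZ k G) M} (h : toPoint F = toPoint F') :
    Nonempty (F ⟶ F') := by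
  obtain ⟨τ, hτ⟩ := exists_natIso F.unitIso F'.unitIso fun r => by
    obtain ⟨s, rfl⟩ := (scalarEquiv k G).surjective r
    exact DFunLike.congr_fun h s
  exact ⟨τ, isMonoidal_of_unit τ.hom hτ⟩

lemma exists_toPoint_eq [IsIdempotentComplete M]
    (x : (IrrChar k G → k) →ₐ[Λ] End (𝟙_ M)) :
    ∃ F : TensFun Λ k (RepZ k G) M, toPoint F = x := by
  obtain ⟨F, hF, e, he⟩ := exists_functor (A := RepZ k G) (M := M)
    ((x : _ →+* _).comp (scalarEquiv k G).symm.toRingHom)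
  have he' (r : IrrChar k G → k) : unitMap e (scalarEquiv k G r) = x r := by
    have := DFunLike.congr_fun he (scalarEquiv k G r)
    refine this.trans ?_
    change x ((scalarEquiv k G).symm _) = _
    rw [RingEquiv.symm_apply_apply]
  obtain ⟨t, ht⟩ := exists_braided (F := F) e
  refine ⟨⟨F, t, fun r _ _ f => map_smul_of_unitMap e (fun r => ?_) r f,
    preservesColimits_of_hasEnoughForms (scalarEquiv k G) (hasEnoughForms_pi _ _)
      (hasEnoughForms_pi _ _) F e⟩, AlgHom.ext fun r => ?_⟩
  · have h := he' (algebraMap k _ (algebraMap Λ k r))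
    rw [scalarEquiv_algebraMap] at h
    refine h.trans ((x.commutes r).trans ?_)
    rw [Algebra.algebraMap_eq_smul_one]
    rfl
  · rw [toPoint_apply, ← he']
    exact unitMap_congr _ _ (Iso.refl F) _

omit [MonoidalPreadditive M] in
lemma toPoint_pre (α : G ≃* G) [(resZ (k := k) α).Braided] (F : TensFun Λ k (RepZ k G) M) :
    toPoint ((TensFun.pre (resZ α)).obj F) = (toPoint F).comp (sigma Λ α).toAlgHom := by
  ext r
  change unitMap _ _ = unitMap F.unitIso (scalarEquiv k G (sigma Λ α r))
  rw [scalarEquiv_sigma Λ α (Functor.Monoidal.εIso (resZ (k := k) α))]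
  exact unitMap_comp_functor _ _ _ _

end Classification

/-! ### Monoidal natural isomorphisms between the functors `κ'(α_ij)` -/

section TensorFamily

variable {k G : Type u} [Field k] [IsAlgClosed k] [CharZero k] [Group G] [Finite G]
  {ι : Type w'} (α : ι → ι → G ≃* G)

/-- Monoidal natural isomorphisms exist uniquely as soon as any natural isomorphisms exist. -/
lemma existsUnique_tensorFamily (t : ∀ i j, (resZ (k := k) (α i j)).Braided)
    (ν : ∀ i j l, resZ (α j l) ⋙ resZ (α i j) ≅ resZ (k := k) (α i l)) :
    ∃ μ, IsTensorFamily α t μ ∧ ∀ μ', IsTensorFamily α t μ' → μ' = μ := by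
  have h (i j l) := exists_natIso
    (Functor.Monoidal.εIso (resZ (k := k) (α j l) ⋙ resZ (k := k) (α i j)))
    (Functor.Monoidal.εIso (resZ (k := k) (α i l))) (unitMap_congr _ _ (ν i j l))
  choose μ hμ using h
  refine ⟨μ, fun i j l => isMonoidal_of_unit _ (hμ i j l), fun μ' hμ' => ?_⟩
  funext i j l
  refine Iso.ext (natTrans_ext (Functor.Monoidal.εIso (resZ (α j l) ⋙ resZ (α i j))) _ _ ?_)
  exact ((hμ' i j l).unit).trans (hμ i j l).symm

/-- The tensor structures are determined by isomorphisms `e_ij : 𝟙 ≅ κ'(α_ij) 𝟙`. Fix an index `o`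
and take any isomorphisms `e_oj`; then `e_ij` is the one for which `μ_oij` is monoidal. The cocycle
condition for `β` implies that all `μ_ijl` are monoidal. -/
lemma exists_isTensorFamily_muZ (β : ι → ι → ι → G)
    (hα : ∀ i j l g, α j l (α i j g) = α i l ((β i j l)⁻¹ * g * β i j l))
    (hβ : ∀ i j l m, (α i j).symm (β j l m) * β i j m = β i j l * β i l m) :
    ∃ t : ∀ i j, (resZ (k := k) (α i j)).Braided, IsTensorFamily α t
      (fun i j l => muZ (α i j) (α j l) (α i l) (β i j l) (hα i j l)) := by
  rcases isEmpty_or_nonempty ι with hι | ⟨⟨o⟩⟩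
  · exact ⟨fun i => hι.elim i, fun i => hι.elim i⟩
  let μ (i j l) := muZ (k := k) (α i j) (α j l) (α i l) (β i j l) (hα i j l)
  -- the condition on `β` says that the `μ`'s satisfy the tetrahedron condition
  have tetra (i j l : ι) (V : RepZ k G) : (resZ (α o i)).map ((μ i j l).hom.app V) ≫
      (μ o i l).hom.app V = (μ o i j).hom.app ((resZ (α j l)).obj V) ≫ (μ o j l).hom.app V := by
    refine Action.Hom.ext ?_
    let V' : FDRep k G := V
    change Action.ρ V' (α i l (β i j l)) ≫ Action.ρ V' (α o l (β o i l)) =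
      Action.ρ V' (α j l (α o j (β o i j))) ≫ Action.ρ V' (α o l (β o j l))
    rw [← End.mul_def, ← End.mul_def, ← map_mul, ← map_mul]
    congr 1
    have h1 := hα o i l ((α o i).symm (β i j l))
    rw [MulEquiv.apply_symm_apply] at h1
    rw [h1, hα o j l, ← map_mul, ← map_mul]
    congr 1
    have h2 := hβ o i j l
    simp only [mul_assoc, mul_inv_cancel_left]
    exact h2
  -- `d i j` makes `μ o i j` compatible with the units `e i`, `d i j` and `e j`
  let e (j : ι) := unitIsoResZ (k := k) (α o j)
  let d (i j : ι) : 𝟙_ (RepZ k G) ≅ (resZ (α i j)).obj (𝟙_ (RepZ k G)) :=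
    (resZ (α o i)).preimageIso ((e i).symm ≪≫ e j ≪≫ (μ o i j).symm.app _)
  have hd (i j : ι) : (resZ (α o i)).map (d i j).hom =
      (e i).inv ≫ (e j).hom ≫ (μ o i j).inv.app _ := by
    simp [d]
  choose t ht using fun i j => exists_braided (d i j)
  refine ⟨t, fun i j l => isMonoidal_of_unit _ ?_⟩
  rw [Functor.LaxMonoidal.comp_ε, ht, ht, ht]
  apply (resZ (α o i)).map_injective
  have h := tetra i j l (𝟙_ _)
  have h3 := (μ o i j).inv.naturality (d j l).hom
  simp only [Functor.comp_map] at h3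
  change (resZ (α o i)).map (((d i j).hom ≫ (resZ (α i j)).map (d j l).hom) ≫
    (μ i j l).hom.app (𝟙_ _)) = _
  rw [Functor.map_comp, Functor.map_comp, hd, hd]
  simp only [Category.assoc]
  rw [← reassoc_of% h3, hd, ← cancel_mono ((μ o i l).hom.app _)]
  simp only [Category.assoc, h]
  simp

end TensorFamily

/-! ### Fibred categories equivalent to presheaves of sets -/

section Classification

variable {C : Type u₁} [Category.{v₁} C] {D : Type u₃} [Category.{v₃} D]
  {E : Type u₄} [Category.{v₄} E]

/-- A classification of the objects of a category fibred in groupoids without nontrivial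
automorphisms by the sections of a presheaf of sets `P`, that is, an equivalence with `P`. -/
structure Classification (X : FibCat.{v', u'} C) (P : Cᵒᵖ ⥤ Type w) where
  /-- the class of an object -/
  cls {S : C} (x : Fib X S) : P.obj (op S)
  cls_pull {S' S : C} (f : S' ⟶ S) (x : Fib X S) : cls ((pull X f).obj x) = P.map f.op (cls x)
  surjective {S : C} (s : P.obj (op S)) : ∃ x : Fib X S, cls x = s
  nonempty_hom {S : C} {x y : Fib X S} : cls x = cls y → Nonempty (x ⟶ y)
  cls_eq_of_hom {S : C} {x y : Fib X S} (f : x ⟶ y) : cls x = cls y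
  subsingleton {S : C} (x y : Fib X S) : Subsingleton (x ⟶ y)

namespace Classification

variable {X : FibCat.{v', u'} C} {P : Cᵒᵖ ⥤ Type w} (c : Classification X P)

include c in
lemma isIso {S : C} {x y : Fib X S} (f : x ⟶ y) : IsIso f := by
  obtain ⟨g⟩ := c.nonempty_hom (c.cls_eq_of_hom f).symm
  exact ⟨g, (c.subsingleton _ _).elim _ _, (c.subsingleton _ _).elim _ _⟩

/-- Objects in the same class are isomorphic. -/
def iso {S : C} {x y : Fib X S} (h : c.cls x = c.cls y) : x ≅ y where
  hom := (c.nonempty_hom h).some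
  inv := (c.nonempty_hom h.symm).some
  hom_inv_id := (c.subsingleton _ _).elim _ _
  inv_hom_id := (c.subsingleton _ _).elim _ _

include c in
/-- A fibred category equivalent to a sheaf of sets is a stack. -/
lemma isGroupoidStack {J : GrothendieckTopology C} (hP : Presieve.IsSheaf J P) :
    IsGroupoidStack J X where
  isIso := c.isIso
  isStack := .of_isStackFor fun S R hR => ⟨by
    let F := X.toDescentData fun f : R.arrows.category => f.obj.hom
    have faithful : F.Faithful := ⟨fun _ => (c.subsingleton _ _).elim _ _⟩
    have full : F.Full := by
      refine ⟨fun {M N} f => ?_⟩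
      have h : c.cls M = c.cls N := (hP R hR).isSeparatedFor.ext fun Y g hg => by
        rw [← c.cls_pull, ← c.cls_pull]
        exact c.cls_eq_of_hom (f.hom ⟨Over.mk g, hg⟩)
      refine ⟨(c.nonempty_hom h).some, ?_⟩
      ext i
      exact (c.subsingleton _ _).elim _ _
    have essSurj : F.EssSurj := by
      refine ⟨fun d => ?_⟩
      let x : Presieve.FamilyOfElements P R.arrows := fun Y g hg =>
        c.cls (d.obj ⟨Over.mk g, hg⟩)
      have hx : x.Compatible := fun Y₁ Y₂ Z g₁ g₂ f₁ f₂ h₁ h₂ w => by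
        refine (c.cls_pull g₁ _).symm.trans (Eq.trans ?_ (c.cls_pull g₂ _))
        exact c.cls_eq_of_hom (d.hom (g₁ ≫ f₁) (i₁ := ⟨Over.mk f₁, h₁⟩) (i₂ := ⟨Over.mk f₂, h₂⟩)
          g₁ g₂ rfl w.symm)
      obtain ⟨s, hs, -⟩ := hP R hR x hx
      obtain ⟨M, rfl⟩ := c.surjective s
      exact ⟨M, ⟨Pseudofunctor.DescentData.isoMk
        (fun i => c.iso ((c.cls_pull _ _).trans (hs i.obj.hom i.property)))
        (fun _ _ _ _ _ _ _ _ => (c.subsingleton _ _).elim _ _)⟩⟩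
    exact { }⟩

variable {Y : FibCat.{v'', u''} D} {Q : Dᵒᵖ ⥤ Type w'} (d : Classification Y Q)

/-- The functor between fibres given by a map between the sets of classes. -/
def functor {S : C} {T : D} (m : P.obj (op S) → Q.obj (op T)) : Fib X S ⥤ Fib Y T where
  obj x := (d.surjective (m (c.cls x))).choose
  map {x y} f := (d.nonempty_hom (by
    rw [(d.surjective _).choose_spec, (d.surjective _).choose_spec, c.cls_eq_of_hom f])).some
  map_id _ := (d.subsingleton _ _).elim _ _
  map_comp _ _ := (d.subsingleton _ _).elim _ _

lemma cls_functor {S : C} {T : D} (m : P.obj (op S) → Q.obj (op T)) (x : Fib X S) :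
    d.cls ((c.functor d m).obj x) = m (c.cls x) := (d.surjective (m (c.cls x))).choose_spec

include c d in
lemma isEquivalence_of_bijective {S : C} {T : D} (F : Fib X S ⥤ Fib Y T)
    (m : P.obj (op S) → Q.obj (op T)) (hm : Function.Bijective m)
    (hF : ∀ x, d.cls (F.obj x) = m (c.cls x)) : F.IsEquivalence := by
  have faithful : F.Faithful := ⟨fun _ => (c.subsingleton _ _).elim _ _⟩
  have full : F.Full := ⟨fun {x y} f => by
    have h := d.cls_eq_of_hom f
    rw [hF, hF] at h
    exact ⟨(c.nonempty_hom (hm.1 h)).some, (d.subsingleton _ _).elim _ _⟩⟩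
  have essSurj : F.EssSurj := ⟨fun y => by
    obtain ⟨s, hs⟩ := hm.2 (d.cls y)
    obtain ⟨x, rfl⟩ := c.surjective s
    exact ⟨x, ⟨d.iso ((hF x).trans hs)⟩⟩⟩
  exact { }

variable {U : E ⥤ C} {V : E ⥤ D}

/-- The morphism of fibred categories given by a morphism between the presheaves of classes. -/
def fibHom (m : ∀ S : E, P.obj (op (U.obj S)) → Q.obj (op (V.obj S)))
    (hm : ∀ {S' S : E} (f : S' ⟶ S) (s : P.obj (op (U.obj S))),
      m S' (P.map (U.map f).op s) = Q.map (V.map f).op (m S s)) : FibHom U X V Y where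
  app S := c.functor d (m S)
  iso f := NatIso.ofComponents
    (fun x => d.iso (by
      refine (c.cls_functor d _ _).trans (Eq.trans ?_ (d.cls_pull _ _).symm)
      rw [c.cls_pull, hm, c.cls_functor]))
    (fun _ => (d.subsingleton _ _).elim _ _)
  iso_id _ _ := (d.subsingleton _ _).elim _ _
  iso_comp _ _ _ := (d.subsingleton _ _).elim _ _

lemma cls_fibHom (m : ∀ S : E, P.obj (op (U.obj S)) → Q.obj (op (V.obj S)))
    (hm : ∀ {S' S : E} (f : S' ⟶ S) (s : P.obj (op (U.obj S))),
      m S' (P.map (U.map f).op s) = Q.map (V.map f).op (m S s)) (S : E) (x : Fib X (U.obj S)) :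
    d.cls (((c.fibHom d m hm).app S).obj x) = m S (c.cls x) := c.cls_functor d (m S) x

lemma isEquiv_fibHom (m : ∀ S : E, P.obj (op (U.obj S)) → Q.obj (op (V.obj S)))
    (hm : ∀ {S' S : E} (f : S' ⟶ S) (s : P.obj (op (U.obj S))),
      m S' (P.map (U.map f).op s) = Q.map (V.map f).op (m S s))
    (hm' : ∀ S, Function.Bijective (m S)) : (c.fibHom d m hm).IsEquiv := fun S =>
  c.isEquivalence_of_bijective d _ (m S) (hm' S) (c.cls_fibHom d m hm S)

/-- Morphisms of fibred categories that agree on classes are isomorphic. -/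
def fibIso {Φ Ψ : FibHom U X V Y}
    (h : ∀ (S : E) (x : Fib X (U.obj S)), d.cls ((Φ.app S).obj x) = d.cls ((Ψ.app S).obj x)) :
    FibIso Φ Ψ where
  app S := NatIso.ofComponents (fun x => d.iso (h S x)) (fun _ => (d.subsingleton _ _).elim _ _)
  naturality _ _ := (d.subsingleton _ _).elim _ _

end Classification

/-- The classification of the objects of a category fibred in sets, up to a change of universe. -/
def setClassification (P : Cᵒᵖ ⥤ Type w) :
    Classification ((P ⋙ uliftFunctor.{w'} ⋙ typeToCat).toPseudofunctor' : FibCat C) P where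
  cls x := ULift.down (Discrete.as x)
  cls_pull _ _ := rfl
  surjective s := ⟨Discrete.mk (ULift.up s), rfl⟩
  nonempty_hom h := ⟨Discrete.eqToHom (ULift.ext _ _ h)⟩
  cls_eq_of_hom f := congrArg ULift.down (Discrete.eq_of_hom f)
  subsingleton _ _ := inferInstanceAs (Subsingleton (Discrete.mk _ ⟶ Discrete.mk _))

end Classification

/-! ### `Spec R` as a presheaf and as a fibred category -/

section Spec

variable {C : Type u₁} [Category.{v₁} C] (Λ : Type w) [CommRing Λ]
  (B : FibCat.{v₂, u₂} C) [AbelianTensorFibred B] [LinearFibred Λ B]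

/-- The classification of the objects of `Spec R` by themselves. -/
def specClassification (R : Type w') [CommRing R] [Algebra Λ R] :
    Classification (specFib Λ B R) (specPresheaf Λ B R) where
  cls x := Discrete.as x
  cls_pull _ _ := rfl
  surjective s := ⟨Discrete.mk s, rfl⟩
  nonempty_hom h := ⟨Discrete.eqToHom h⟩
  cls_eq_of_hom f := Discrete.eq_of_hom f
  subsingleton _ _ := inferInstanceAs (Subsingleton (Discrete.mk _ ⟶ Discrete.mk _))

end Spec

/-! ### Descent for the functor of points of `Spec R` -/

section SpecSheaf

variable {C : Type u₁} [Category.{v₁} C] (Λ : Type w) [CommRing Λ]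
  (B : FibCat.{v₂, u₂} C) [AbelianTensorFibred B] [LinearFibred Λ B]

/-- The presheaf `S ↦ End (u_S)`, without its ring structure. -/
def endPresheaf : Cᵒᵖ ⥤ Type v₂ where
  obj S := End (𝟙_ (Fib B S.unop))
  map f := ↾fun x => pullEnd Λ B f.unop x
  map_id S := by
    refine ConcreteCategory.hom_ext _ _ fun x => ?_
    exact pullEnd_id Λ B x
  map_comp f g := by
    refine ConcreteCategory.hom_ext _ _ fun x => ?_
    exact pullEnd_comp Λ B g.unop f.unop x

/-- On objects over `S`, endomorphisms of the unit object are endomorphisms of the pull-back of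
`u_S`. -/
def endPresheafIso (S : C) : (Over.forget S).op ⋙ endPresheaf Λ B ≅
    B.presheafHom (𝟙_ (Fib B S)) (𝟙_ (Fib B S)) :=
  NatIso.ofComponents
    (fun T => Equiv.toIso (Iso.homCongr (Functor.Monoidal.εIso (pull B T.unop.hom))
      (Functor.Monoidal.εIso (pull B T.unop.hom))))
    (fun {T T'} f => by
      refine ConcreteCategory.hom_ext _ _ fun (x : 𝟙_ (Fib B T.unop.left) ⟶ 𝟙_ _) => ?_
      have w := Over.w f.unop
      have h' := NatTrans.IsMonoidal.unit
        (τ := (pullComp B f.unop.left T.unop.hom T'.unop.hom w).hom)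
      change Functor.OplaxMonoidal.η (pull B T'.unop.hom) ≫
        (Functor.LaxMonoidal.ε (pull B f.unop.left) ≫ (pull B f.unop.left).map x ≫
          Functor.OplaxMonoidal.η (pull B f.unop.left)) ≫
            Functor.LaxMonoidal.ε (pull B T'.unop.hom) =
        (pullComp B f.unop.left T.unop.hom T'.unop.hom w).hom.app _ ≫
          (pull B f.unop.left).map (Functor.OplaxMonoidal.η (pull B T.unop.hom) ≫ x ≫
            Functor.LaxMonoidal.ε (pull B T.unop.hom)) ≫
              (pullComp B f.unop.left T.unop.hom T'.unop.hom w).inv.app _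
      rw [← cancel_epi (Functor.LaxMonoidal.ε (pull B T'.unop.hom)),
        ← cancel_mono ((pullComp B f.unop.left T.unop.hom T'.unop.hom w).hom.app _)]
      simp only [Category.assoc, Functor.Monoidal.ε_η_assoc, Iso.inv_hom_id_app, h']
      rw [reassoc_of% h']
      simp)

variable {J : GrothendieckTopology C}

lemma isSheaf_endPresheaf (hB : B.IsPrestack J) : Presieve.IsSheaf J (endPresheaf Λ B) := by
  intro S R hR x hx
  have hs : Presieve.IsSheaf (J.over S) ((Over.forget S).op ⋙ endPresheaf Λ B) :=
    Presieve.isSheaf_iso _ (endPresheafIso Λ B S).symm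
      ((isSheaf_iff_isSheaf_of_type _ _).1 (hB.isSheaf (𝟙_ (Fib B S)) (𝟙_ (Fib B S))))
  -- the sieve `R` on `S` is a sieve on the final object of `C / S`
  let R' : Sieve (Over.mk (𝟙 S)) := (Sieve.overEquiv (Over.mk (𝟙 S))).symm R
  have hR' : R' ∈ (J.over S) (Over.mk (𝟙 S)) := by
    rw [GrothendieckTopology.mem_over_iff]
    simpa [R'] using hR
  have mem {Y : Over S} (g : Y ⟶ Over.mk (𝟙 S)) (hg : R' g) : R g.left :=
    (Sieve.overEquiv_symm_iff R g).1 hg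
  let x' : Presieve.FamilyOfElements ((Over.forget S).op ⋙ endPresheaf Λ B) R'.arrows :=
    fun Y g hg => x g.left (mem g hg)
  have hx' : x'.Compatible := fun Y₁ Y₂ Z g₁ g₂ f₁ f₂ h₁ h₂ w' =>
    hx g₁.left g₂.left (mem f₁ h₁) (mem f₂ h₂) (congrArg CommaMorphism.left w')
  obtain ⟨t, ht, ht'⟩ := hs R' hR' x' hx'
  refine ⟨t, fun Y g hg => ?_, fun t' h => ht' t' fun Y g hg => h g.left (mem g hg)⟩
  let g' : Over.mk g ⟶ Over.mk (𝟙 S) := Over.homMk g (Category.comp_id g)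
  exact ht g' ((Sieve.overEquiv_symm_iff R g').2 hg)

/-- As the presheaf of endomorphisms of the unit objects is a sheaf, so is the functor of points of
an affine scheme. -/
lemma isSheaf_specPresheaf (hB : B.IsPrestack J) (R : Type w') [CommRing R] [Algebra Λ R] :
    Presieve.IsSheaf J (specPresheaf Λ B R) := by
  intro S U hU x hx
  have hE := isSheaf_endPresheaf Λ B hB
  have sep {a b : End (𝟙_ (Fib B S))}
      (h : ∀ ⦃Y : C⦄ (f : Y ⟶ S), U f → pullEnd Λ B f a = pullEnd Λ B f b) : a = b :=
    (hE U hU).isSeparatedFor.ext (P := endPresheaf Λ B) h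
  have h (r : R) : ∃ t : End (𝟙_ (Fib B S)), ∀ {Y : C} (f : Y ⟶ S) (hf : U f),
      pullEnd Λ B f t = (show R →ₐ[Λ] End (𝟙_ (Fib B Y)) from x f hf) r := by
    obtain ⟨t, ht, -⟩ := hE U hU
      (fun Y f hf => (show R →ₐ[Λ] End (𝟙_ (Fib B Y)) from x f hf) r)
      (fun Y₁ Y₂ Z g₁ g₂ f₁ f₂ h₁ h₂ w' => DFunLike.congr_fun
        (show (_ : R →ₐ[Λ] End (𝟙_ (Fib B Z))) = _ from hx g₁ g₂ h₁ h₂ w') r)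
    exact ⟨t, fun f hf => ht f hf⟩
  choose t ht using h
  let s : R →ₐ[Λ] End (𝟙_ (Fib B S)) :=
    { toFun := t
      map_one' := sep fun Y f hf => by rw [ht _ f hf, map_one, map_one]
      map_mul' := fun a b => sep fun Y f hf => by
        rw [map_mul, ht _ f hf, ht _ f hf, ht _ f hf, map_mul]
      map_zero' := sep fun Y f hf => by rw [ht _ f hf, map_zero, map_zero]
      map_add' := fun a b => sep fun Y f hf => by
        rw [map_add, ht _ f hf, ht _ f hf, ht _ f hf, map_add]
      commutes' := fun a => sep fun Y f hf => by
        rw [ht _ f hf, AlgHom.commutes, AlgHom.commutes] }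
  refine ⟨s, fun Y f hf => AlgHom.ext fun r => ht r f hf, fun s' hs' => ?_⟩
  refine AlgHom.ext fun r => sep fun Y f hf => ?_
  exact (DFunLike.congr_fun (show (_ : R →ₐ[Λ] End (𝟙_ (Fib B Y))) = _ from hs' f hf) r).trans
    (ht r f hf).symm

end SpecSheaf

/-! ### The fibred category of tensor functors -/

section Tens

instance fibHasFiniteBiproducts {C : Type u₁} [Category.{v₁} C] (B : FibCat.{v₂, u₂} C)
    [AbelianTensorFibred B] (S : C) : HasFiniteBiproducts (Fib B S) :=
  Abelian.hasFiniteBiproducts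

variable {C : Type u₁} [Category.{v₁} C] {D : Type u₃} [Category.{v₃} D]
  (Λ : Type w) [CommRing Λ] {k G : Type u} [Field k] [IsAlgClosed k] [CharZero k]
  [Algebra Λ k] [Group G] [Finite G]
  (B : FibCat.{v₂, u₂} C) [AbelianTensorFibred B] [LinearFibred Λ B]

lemma toPoint_tensPull {S' S : C} (f : S' ⟶ S) (F : TensFun Λ k (RepZ k G) (Fib B S)) :
    toPoint ((tensPull Λ k (RepZ k G) B f).obj F) = (pullEnd Λ B f).comp (toPoint F) :=
  AlgHom.ext fun _ => unitMap_comp_functor F.unitIso (Functor.Monoidal.εIso (pull B f)) _ _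

/-- Tensor functors `A_Z ⥤ B_S` are classified by the points of `Spec (k ^ Ĝ)`. -/
def tensClassification (P : D ⥤ C) : Classification (tensStack Λ k (RepZ k G) (restr P B))
    (P.op ⋙ specPresheaf Λ B (IrrChar k G → k)) where
  cls {S} F := toPoint (M := Fib B (P.obj S)) F
  cls_pull f F := toPoint_tensPull Λ B (P.map f) F
  surjective {S} x := exists_toPoint_eq (M := Fib B (P.obj S)) x
  nonempty_hom {S _ _} h := nonempty_hom_of_toPoint_eq (M := Fib B (P.obj S)) h
  cls_eq_of_hom {S _ _} f := toPoint_eq_of_hom (M := Fib B (P.obj S)) f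
  subsingleton {S} F F' := tensFun_subsingleton (M := Fib (restr P B) S) F F'

lemma isSheaf_over {J : GrothendieckTopology C} (hB : B.IsPrestack J) (R : Type w') [CommRing R]
    [Algebra Λ R] (T : C) :
    Presieve.IsSheaf (J.over T) ((Over.forget T).op ⋙ specPresheaf Λ B R) :=
  Functor.op_comp_isSheaf_of_isSheaf_type (F := Over.forget T) (J.over T)
    (isSheaf_specPresheaf Λ B hB R)

end Tens

/-! ### The descent datum and its gluing -/

section Gluing

lemma comp_sigma_sigma {Λ : Type w} [CommRing Λ] {k G : Type u} [Field k] [IsAlgClosed k]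
    [CharZero k] [Algebra Λ k] [Group G] [Finite G] {α₁ α₂ α₃ : G ≃* G}
    (μ : resZ α₂ ⋙ resZ α₁ ≅ resZ (k := k) α₃) {R : Type w'} [Ring R] [Algebra Λ R]
    (x : (IrrChar k G → k) →ₐ[Λ] R) :
    (x.comp (sigma Λ α₁).toAlgHom).comp (sigma Λ α₂).toAlgHom = x.comp (sigma Λ α₃).toAlgHom :=
  AlgHom.ext fun r => congrArg x (sigma_sigma Λ μ r)

lemma comp_sigma_bijective {Λ : Type w} [CommRing Λ] {k G : Type u} [Field k] [IsAlgClosed k]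
    [CharZero k] [Algebra Λ k] [Group G] [Finite G] (α : G ≃* G) {R : Type w'} [Ring R]
    [Algebra Λ R] : Function.Bijective
      fun x : (IrrChar k G → k) →ₐ[Λ] R => x.comp (sigma Λ α).toAlgHom :=
  (AlgEquiv.arrowCongr (sigma Λ α).symm AlgEquiv.refl).bijective

variable {C : Type u₁} [Category.{v₁} C] {Λ : Type w} [CommRing Λ] {k G : Type u} [Field k]
  [IsAlgClosed k] [CharZero k] [Algebra Λ k] [Group G] [Finite G]
  (B : FibCat.{v₂, u₂} C) [AbelianTensorFibred B] [LinearFibred Λ B]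
  {ι : Type w'} (T : ι → C) {α : ι → ι → G ≃* G} (t : ∀ i j, (resZ (k := k) (α i j)).Braided)
  (μ : ∀ i j l, resZ (α j l) ⋙ resZ (α i j) ≅ resZ (k := k) (α i l))
  (hμ : IsTensorFamily α t μ)

/-- On classes, the morphism of stacks given by `κ'(α_ij)` is `σ_ij`. -/
lemma cls_dualData (i j : ι) (S : Over2 (T i) (T j))
    (F : TensFun Λ k (RepZ k G) (Fib B S.pt)) :
    (tensClassification Λ B (Over.forget (T j))).cls (S := Over.mk S.a₂)
        ((((dualData Λ B T α t μ hμ).χ i j).app S).obj F) =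
      AlgHom.comp (toPoint F) (sigma Λ (α i j)).toAlgHom :=
  toPoint_pre (α i j) F

lemma isTwoDescentDatum_dualData {J : GrothendieckTopology C} (hB : B.IsPrestack J) :
    (dualData Λ B T α t μ hμ).IsTwoDescentDatum J where
  isStack i := (tensClassification Λ B (Over.forget (T i))).isGroupoidStack
    (isSheaf_over Λ B hB _ (T i))
  isEquiv i j S := (tensClassification Λ B (Over.forget (T i))).isEquivalence_of_bijective
    (tensClassification Λ B (Over.forget (T j))) _
    (fun x : (IrrChar k G → k) →ₐ[Λ] End (𝟙_ (Fib B S.pt)) => x.comp (sigma Λ (α i j)).toAlgHom)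
    (comp_sigma_bijective _)
    (cls_dualData B T t μ hμ i j S)
  tetrahedron _ _ _ m _ _ _ _ d _ :=
    ((tensClassification Λ B (Over.forget (T m))).subsingleton (S := Over.mk d) _ _).elim _ _

variable {Y : FibCat.{v', u'} C} (c : Classification Y (specPresheaf Λ B (IrrChar k G → k)))
  (α)

/-- The automorphism `σ_oi` of the functor of points of `Spec (k ^ Ĝ)` over `T_i`. -/
def twistPoint (o i : ι) (S : Over (T i)) (x : (IrrChar k G → k) →ₐ[Λ] End (𝟙_ (Fib B S.left))) :
    (IrrChar k G → k) →ₐ[Λ] End (𝟙_ (Fib B S.left)) := x.comp (sigma Λ (α o i)).toAlgHom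

/-- The equivalence `Y|_{T_i} ⟶ \uline{A_Z}(B_{/T_i})` that is `σ_oi` on classes. -/
def twist (o i : ι) : FibHom (Over.forget (T i)) Y (𝟭 (Over (T i)))
    (tensSlice Λ k (RepZ k G) B (T i)) :=
  c.fibHom (tensClassification Λ B (Over.forget (T i)))
    (twistPoint B T α o i) (fun _ _ => rfl)

lemma cls_twist (o i : ι) {S : C} (a : S ⟶ T i) (y : Fib Y S) :
    (tensClassification Λ B (Over.forget (T i))).cls (S := Over.mk a)
        (((twist B T α c o i).app (Over.mk a)).obj y) =
      AlgHom.comp (c.cls y) (sigma Λ (α o i)).toAlgHom :=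
  c.cls_fibHom (U := Over.forget (T i)) (V := 𝟭 _)
    (tensClassification Λ B (Over.forget (T i))) (twistPoint B T α o i)
    (fun _ _ => rfl) (Over.mk a) y

lemma isEquiv_twist (o i : ι) : (twist B T α c o i).IsEquiv :=
  c.isEquiv_fibHom (U := Over.forget (T i)) (V := 𝟭 _)
    (tensClassification Λ B (Over.forget (T i))) (twistPoint B T α o i)
    (fun _ _ => rfl) fun _ => comp_sigma_bijective _

lemma cls_dualData_twist (o i j : ι) (S : Over2 (T i) (T j)) (y : Fib Y S.pt) :
    (tensClassification Λ B (Over.forget (T j))).cls (S := Over.mk S.a₂)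
        ((((dualData Λ B T α t μ hμ).χ i j).app S).obj
          (((twist B T α c o i).app (Over.mk S.a₁)).obj y)) =
      (tensClassification Λ B (Over.forget (T j))).cls (S := Over.mk S.a₂)
        (((twist B T α c o j).app (Over.mk S.a₂)).obj y) := by
  refine (cls_dualData B T t μ hμ i j S _).trans
    (Eq.trans ?_ (cls_twist B T α c o j S.a₂ y).symm)
  refine Eq.trans (congrArg (fun x : (IrrChar k G → k) →ₐ[Λ] End (𝟙_ (Fib B S.pt)) =>
    x.comp (sigma Λ (α i j)).toAlgHom) (cls_twist B T α c o i S.a₁ y)) ?_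
  exact comp_sigma_sigma (R := End (𝟙_ (Fib B S.pt))) (μ o i j) (c.cls y)

/-- The automorphisms `σ_ij` of `Spec (k ^ Ĝ)` form a cocycle on the set of all pairs of indices, so
that `σ_ij` is the quotient of `σ_oj` and `σ_oi` for any index `o`. Twisting the classification of
`tensStack` over `T_i` by `σ_oi` therefore trivializes the descent datum. -/
def gluing (o : ι) : (dualData Λ B T α t μ hμ).Gluing Y where
  ψ := twist B T α c o
  isEquiv := isEquiv_twist B T α c o
  θ i j := (tensClassification Λ B (Over.forget (T j))).fibIso
    fun S y => cls_dualData_twist B T α t μ hμ c o i j S y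
  compat _ _ l _ _ _ e _ :=
    ((tensClassification Λ B (Over.forget (T l))).subsingleton (S := Over.mk e) _ _).elim _ _

include c in
lemma nonempty_gluing : Nonempty ((dualData Λ B T α t μ hμ).Gluing Y) := by
  rcases isEmpty_or_nonempty ι with hι | ⟨⟨o⟩⟩
  · exact ⟨{
      ψ := fun i => hι.elim i
      isEquiv := fun i => hι.elim i
      θ := fun i => hι.elim i
      compat := fun i => hι.elim i }⟩
  · exact ⟨gluing B T α t μ hμ c o⟩

end Gluing

end

end DualGerbe

open DualGerbe

theorem mainTheorem7
    {Λ : Type w} [CommRing Λ]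
    {k G : Type u} [Field k] [IsAlgClosed k] [CharZero k] [Algebra Λ k] [Group G] [Finite G]
    {C : Type u₁} [Category.{v₁} C] (J : GrothendieckTopology C)
    (B : FibCat.{v₂, u₂} C) [AbelianTensorFibred B] [LinearFibred Λ B] (hB : B.IsStack J)
    {S₀ : C} (hS₀ : IsTerminal S₀)
    {ι : Type w'} (T : ι → C) (p : ∀ i, T i ⟶ S₀) (hT : Sieve.ofArrows T p ∈ J S₀)
    (α : ι → ι → G ≃* G) (β : ι → ι → ι → G)
    (hα : ∀ i j l g, α j l (α i j g) = α i l ((β i j l)⁻¹ * g * β i j l))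
    (hβ : ∀ i j l m, (α i j).symm (β j l m) * β i j m = β i j l * β i l m) :
    (∃ t : ∀ i j, (resZ (k := k) (α i j)).Braided,
      IsTensorFamily α t
        (fun i j l => muZ (α i j) (α j l) (α i l) (β i j l) (hα i j l))) ∧
    ∀ t : ∀ i j, (resZ (k := k) (α i j)).Braided,
      ∃ (μ : ∀ i j l, resZ (α j l) ⋙ resZ (α i j) ≅ resZ (k := k) (α i l))
        (hμ : IsTensorFamily α t μ),
        (∀ μ', IsTensorFamily α t μ' → μ' = μ) ∧
        (dualData Λ B T α t μ hμ).IsTwoDescentDatum J ∧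
        ∃ Y : FibCat.{max u u₁ v₁ u₂ v₂ w w', max u u₁ v₁ u₂ v₂ w w'} C,
          IsGroupoidStack J Y ∧
          Nonempty ((dualData Λ B T α t μ hμ).Gluing Y) ∧
          ∀ i, ∃ Ψ : FibHom (Over.forget (T i)) Y (Over.forget (T i))
            (specFib Λ B (IrrChar k G → k)), Ψ.IsEquiv := by
  refine ⟨exists_isTensorFamily_muZ α β hα hβ, fun t => ?_⟩
  obtain ⟨μ, hμ, hμ'⟩ := existsUnique_tensorFamily α t
    fun i j l => muZ (α i j) (α j l) (α i l) (β i j l) (hα i j l)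
  let P := specPresheaf Λ B (IrrChar k G → k)
  let c := setClassification.{_, _, _, max u u₁ v₁ u₂ v₂ w w'} P
  refine ⟨μ, hμ, hμ', isTwoDescentDatum_dualData B T t μ hμ hB.toIsPrestack, _,
    c.isGroupoidStack (isSheaf_specPresheaf Λ B hB.toIsPrestack _), nonempty_gluing B T α t μ hμ c,
    fun i => ⟨c.fibHom (specClassification Λ B _) (fun _ x => x) (fun _ _ => rfl), ?_⟩⟩
  exact c.isEquiv_fibHom _ _ _ fun _ => Function.bijective_id
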